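/- Theorem 2.1. Let $q,m,n,a,b$ be positive integers with $(a,q)=(b,q)=1$, where $(\cdot,\cdot)$ is the greatest common divisor, and set $$V_{\chi,q}(m,n;a,b)=\sum_{\substack{\chi\ (\mathrm{mod}\ q)\\ \chi(-1)=(-1)^m=(-1)^n}}\chi(a)\overline{\chi}(b)L(m,\chi)L(n,\overline{\chi}),$$ the sum being over the Dirichlet characters $\chi$ modulo $q$ that satisfy the stated condition (an empty sum is $0$), and $L(s,\chi)$ being the Dirichlet $L$-function (by analytic continuation at $s=1$). Then $$V_{\chi,q}(m,n;a,b)=\frac{(-1)^{\frac{m-n}{2}}(2\pi)^{m+n}\phi(q)}{4q^{m+n}\,m!\,n!}\Bigl(R(m,n,q;a,b)+R(n,m,q;b,a)+C_1\Bigr),$$ where $(-1)^{\frac{m-n}{2}}=\mathrm{i}^{m-n}$, $$R(m,n,q;a,b)=n\,b^{n-1}\sum_{j=0}^{m}\binom{m}{j}\frac{(-1)^{j}a^{m-j}}{m+n-j}\sum_{l=1}^{b}\overline{B}_{j}\Bigl(\frac{al}{b}\Bigr)\sum_{d\mid q}\mu\Bigl(\frac{q}{d}\Bigr)d^{j}\,\overline{B}_{m+n-j}\Bigl(\frac{dl}{b}\Bigr),$$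 and $$C_{1}=\frac{(-1)^{n-1}m!\,n!\,(a,b)^{m+n}B_{m+n}J_{m+n}(q)}{a^{n}b^{m}(m+n)!}-\delta_{1,m}\delta_{1,n}\frac{\phi(q)}{4}.$$ Here $\phi$ is Euler's totient function, $\mu$ is the Möbius function, $\delta$ is the Kronecker delta, $B_k$ is the $k$-th Bernoulli number and $B_k(x)$ the $k$-th Bernoulli polynomial, and $J_{\alpha}(q)=q^{\alpha}\prod_{p\mid q}(1-p^{-\alpha})$ ($p$ prime) is the generalized Jordan totient function. The Bernoulli functions are given, for $x\in\mathbb{R}$ with fractional part $\{x\}$, by $\overline{B}_0(x)=1$, $\overline{B}_1(x)=0$ if $x\in\mathbb{Z}$ and $\overline{B}_1(x)=B_1(\{x\})$ if $x\notin\mathbb{Z}$, and $\overline{B}_k(x)=B_k(\{x\})$ for $k\ge 2$. -/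

import Mathlib

open scoped ComplexConjugate

noncomputable section

namespace DirichletMean

open Classical in
/-- The weighted mean value `V_{χ,q}(m, n; a, b)`: the sum over the Dirichlet characters `χ`
modulo `q` with `χ(-1) = (-1)^m = (-1)^n` of `χ(a) χ̄(b) L(m, χ) L(n, χ̄)`. Here `star χ` is the
complex conjugate character, and `LFunction` is the (analytically continued) Dirichlet
`L`-function. -/
def V (q : ℕ) [NeZero q] (m n : ℕ) (a b : ℤ) : ℂ :=
  ∑ χ : DirichletCharacter ℂ q with χ (-1) = (-1) ^ m ∧ ((-1) ^ m : ℂ) = (-1) ^ n,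
    χ (a : ZMod q) * conj (χ (b : ZMod q)) *
      DirichletCharacter.LFunction χ (m : ℂ) * DirichletCharacter.LFunction (star χ) (n : ℂ)

open Classical in
/-- The `n`-th Bernoulli function: `B_n({x})`, except that for `n = 1` it is `0` at integers. -/
def bernoulliBar (n : ℕ) (x : ℝ) : ℝ :=
  if n = 1 ∧ ∃ k : ℤ, x = k then 0 else bernoulliFun n (Int.fract x)

/-- The generalized Jordan totient function `J_α(q) = q^α ∏_{p ∣ q} (1 - p^{-α})`. -/
def jordanTotient (α : ℂ) (q : ℕ) : ℂ :=
  (q : ℂ) ^ α * ∏ p ∈ q.primeFactors, (1 - 1 / (p : ℂ) ^ α)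

/-- The Kronecker delta. -/
def kroneckerDelta (m n : ℕ) : ℂ := if m = n then 1 else 0

/-- The finite sum `R(m, n, q; a, b)`. The integer `m + n - j` is positive since `j ≤ m` and
`n ≥ 1`. -/
def R (m n q a b : ℕ) : ℝ :=
  n * (b : ℝ) ^ (n - 1) *
    ∑ j ∈ Finset.range (m + 1),
      (m.choose j : ℝ) * ((-1) ^ j * (a : ℝ) ^ (m - j) / ((m + n - j : ℕ) : ℝ)) *
        ∑ l ∈ Finset.Icc 1 b, bernoulliBar j ((a : ℝ) * l / b) *
          ∑ d ∈ q.divisors, (ArithmeticFunction.moebius (q / d) : ℝ) * (d : ℝ) ^ j *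
            bernoulliBar (m + n - j) ((d : ℝ) * l / b)

/-- The term `C₁`, in which `bernoulli (m + n)` is the Bernoulli number `B_{m+n}`. -/
def C₁ (m n q a b : ℕ) : ℂ :=
  (-1) ^ (n - 1) * (m.factorial : ℂ) * (n.factorial : ℂ) * (Nat.gcd a b : ℂ) ^ (m + n) *
      ((bernoulli (m + n) : ℚ) : ℂ) * jordanTotient ((m + n : ℕ) : ℂ) q /
    ((a : ℂ) ^ n * (b : ℂ) ^ m * ((m + n).factorial : ℂ)) -
  kroneckerDelta 1 m * kroneckerDelta 1 n * ((Nat.totient q : ℂ) / 4)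

end DirichletMean

end

/-! ### Sums over residue systems. -/

namespace DirichletMean

open Finset

/-! Write `e(t)` for `exp(2πit)`. For `χ` of parity `m`, the Fourier expansion of `B̄_m` turns `L(m,
χ)` into a finite sum `∑ χ(y) c_m(y)`, where `c_m` (`lCoeff`) is a discrete Fourier transform of `x
↦ B̄_m(x/q)` (`LFunction_eq_sum_lCoeff`). For the wrong parity that finite sum is zero, so when `m ≡
n (mod 2)` the parity condition in `V` can be dropped and orthogonality over all characters gives `V
= φ(q) ∑_w c_m(bw) c_n(aw)`, with `w` running over the units (`V_eq_sum_units`).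

Summing `e(-w(bx + ay)/q)` over the units `w` gives a Ramanujan sum, hence a combination over `d ∣
q` of the conditions `d ∣ bx + ay`. Raabe's formula and the parametrization `x = ah`, `y = -bh`
modulo `d` reduce each condition to the Dedekind sum `S_d = ∑_{h mod d} B̄_m(ah/d) B̄_n(bh/d)`
(`sum_units_lCoeff`).

The reciprocity law `barDedekindSum_reciprocity` converts `S_d` into Dedekind sums modulo `b` and
modulo `a`. Weighted by `μ(q/d)` these make up the two `R`-terms, while the remaining terms give
`J_{m+n}(q)` and `φ(q)`, that is, `C₁`. The law comes from expanding `B̄_m(x) B̄_n(y)` into products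
in which one factor is `B̄_j(x - y)` (`barExpansion_eq`): put `x = h/e - i/a`, `y = h/e - j/b` and
sum over `h`, `i`, `j`. The difference `x - y` does not involve `h`, so Raabe's formula collapses
every triple sum to a single one.

If `m + n` is odd, `V` is an empty sum; every `S_d` vanishes by oddness and so does `C₁`, so
reciprocity itself forces the two `R`-terms to cancel. -/

theorem periodic_val_intCast {M : Type*} {a : ℕ} [NeZero a] {g : ℤ → M}
    (hg : Function.Periodic g (a : ℤ)) (k : ℤ) : g ((k : ZMod a).val : ℤ) = g k := by
  rw [ZMod.val_intCast]
  have h := hg.int_mul (-(k / a)) k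
  rw [← h]
  congr 1
  rw [Int.cast_id]
  linear_combination Int.emod_add_mul_ediv k a

theorem sum_range_eq_sum_zmod {M : Type*} [AddCommMonoid M] (a : ℕ) [NeZero a] (g : ℤ → M) :
    ∑ i ∈ range a, g i = ∑ z : ZMod a, g (z.val : ℤ) := by
  refine Finset.sum_bij' (fun i _ => (i : ZMod a)) (fun z _ => z.val) ?_ ?_ ?_ ?_ ?_
  · simp
  · intro z _; simpa using ZMod.val_lt z
  · intro i hi; exact ZMod.val_cast_of_lt (by simpa using hi)
  · intro z _; simp
  · intro i hi; rw [ZMod.val_cast_of_lt (by simpa using hi)]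

theorem sum_range_periodic_shift {M : Type*} [AddCommMonoid M] (a : ℕ) [NeZero a] {g : ℤ → M}
    (hg : Function.Periodic g (a : ℤ)) (c : ℤ) :
    ∑ i ∈ range a, g (i + c) = ∑ i ∈ range a, g i := by
  rw [sum_range_eq_sum_zmod a g, sum_range_eq_sum_zmod a (fun i => g (i + c))]
  refine Fintype.sum_equiv (Equiv.addRight (c : ZMod a)) _ _ fun z => ?_
  have := periodic_val_intCast hg (z.val + c)
  rw [← this]
  simp

theorem sum_range_periodic_neg {M : Type*} [AddCommMonoid M] (a : ℕ) [NeZero a] {g : ℤ → M}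
    (hg : Function.Periodic g (a : ℤ)) :
    ∑ i ∈ range a, g (-i) = ∑ i ∈ range a, g i := by
  rw [sum_range_eq_sum_zmod a g, sum_range_eq_sum_zmod a (fun i => g (-i))]
  refine Fintype.sum_equiv (Equiv.neg (ZMod a)) _ _ fun z => ?_
  have := periodic_val_intCast hg (-z.val)
  rw [← this]
  simp

theorem sum_range_periodic_mul {M : Type*} [AddCommMonoid M] (a : ℕ) [NeZero a] {g : ℤ → M}
    (hg : Function.Periodic g (a : ℤ)) {u : ℕ} (hu : u.Coprime a) :
    ∑ i ∈ range a, g (u * i) = ∑ i ∈ range a, g i := by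
  rw [sum_range_eq_sum_zmod a g, sum_range_eq_sum_zmod a (fun i => g (u * i))]
  refine Fintype.sum_equiv (Units.mulLeft (ZMod.unitOfCoprime u hu)) _ _ fun z => ?_
  have := periodic_val_intCast hg (u * z.val)
  rw [← this]
  simp

theorem sum_Icc_periodic {M : Type*} [AddCommMonoid M] (a : ℕ) [NeZero a] {g : ℤ → M}
    (hg : Function.Periodic g (a : ℤ)) :
    ∑ i ∈ Icc 1 a, g i = ∑ i ∈ range a, g i := by
  rw [← sum_range_periodic_shift a hg 1, Finset.range_eq_Ico, ← Finset.Ico_succ_right_eq_Icc]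
  have := Finset.sum_Ico_add' (fun i : ℕ => g i) 0 a 1
  simpa using this.symm

theorem sum_range_periodic_mul_period {M : Type*} [AddCommMonoid M] (a c : ℕ) [NeZero a]
    {g : ℤ → M} (hg : Function.Periodic g (a : ℤ)) :
    ∑ i ∈ range (c * a), g i = c • ∑ i ∈ range a, g i := by
  induction c with
  | zero => simp
  | succ c ih =>
    rw [Nat.succ_mul, Finset.sum_range_add, ih, succ_nsmul]
    congr 1
    refine Finset.sum_congr rfl fun i _ => ?_
    have := hg.nat_mul c i
    rw [← this]; push_cast; ring_nf

/-! ### Bernoulli functions: periodicity, parity and Raabe's formula. -/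

/-- The only discrepancy is `B_1(0) = -1/2` against the normalized value `0` at integers. Isolating
it lets identities for polynomials be transferred with an explicit correction. -/
theorem bernoulliBar_eq (k : ℕ) (x : ℝ) :
    bernoulliBar k x =
      bernoulliFun k (Int.fract x) + if k = 1 ∧ Int.fract x = 0 then 1 / 2 else 0 := by
  have h : (∃ z : ℤ, x = z) ↔ Int.fract x = 0 := by
    rw [Int.fract_eq_zero_iff]
    simp [eq_comm]
  unfold bernoulliBar
  rw [h]
  split_ifs with h1
  · rw [h1.1, h1.2]; simp
  · simp

theorem bernoulliBar_of_mem_Ico {k : ℕ} {x : ℝ} (h0 : 0 ≤ x) (h1 : x < 1) :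
    bernoulliBar k x = bernoulliFun k x + if k = 1 ∧ x = 0 then 1 / 2 else 0 := by
  rw [bernoulliBar_eq, Int.fract_eq_self.2 ⟨h0, h1⟩]

theorem bernoulliBar_of_ne_one {k : ℕ} (hk : k ≠ 1) (x : ℝ) :
    bernoulliBar k x = bernoulliFun k (Int.fract x) := by
  simp [bernoulliBar_eq, hk]

@[simp]
theorem bernoulliBar_zero (x : ℝ) : bernoulliBar 0 x = 1 := by
  simp [bernoulliBar_of_ne_one]

theorem bernoulliBar_add_int (k : ℕ) (x : ℝ) (c : ℤ) :
    bernoulliBar k (x + c) = bernoulliBar k x := by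
  simp [bernoulliBar_eq]

theorem bernoulliBar_fract (k : ℕ) (x : ℝ) :
    bernoulliBar k (Int.fract x) = bernoulliBar k x := by
  simp [bernoulliBar_eq]

theorem bernoulliBar_neg (k : ℕ) (x : ℝ) :
    bernoulliBar k (-x) = (-1) ^ k * bernoulliBar k x := by
  rw [bernoulliBar_eq, bernoulliBar_eq]
  by_cases h : Int.fract x = 0
  · have h' : Int.fract (-x) = 0 := Int.fract_neg_eq_zero.2 h
    rw [h, h']
    by_cases hk : k = 1
    · subst hk; norm_num
    · have h1 := @bernoulliFun_eval_one_sub k 0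
      rw [sub_zero, bernoulliFun_endpoints_eq_of_ne_one hk] at h1
      simp [hk, ← h1]
  · have h' : Int.fract (-x) ≠ 0 := fun h0 => h (Int.fract_neg_eq_zero.1 h0)
    rw [Int.fract_neg h] at h' ⊢
    simp [h, h', bernoulliFun_eval_one_sub]

theorem bernoulliBar_intCast_div_periodic (k : ℕ) (a : ℕ) [NeZero a] (x : ℝ) (c : ℤ) :
    Function.Periodic (fun i : ℤ => bernoulliBar k (x + c * i / a)) (a : ℤ) := fun i => by
  have ha : (a : ℝ) ≠ 0 := NeZero.ne _
  have : x + c * ((i + (a : ℤ) : ℤ) : ℝ) / a = x + c * i / a + c := by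
    push_cast; field_simp; ring
  simp only [this, bernoulliBar_add_int]

/-- Raabe's multiplication formula for Bernoulli functions. -/
theorem sum_bernoulliBar_add_div (k : ℕ) (a : ℕ) [NeZero a] (x : ℝ) :
    (a : ℝ) ^ k * ∑ i ∈ range a, bernoulliBar k (x + i / a) = a * bernoulliBar k (a * x) := by
  have ha : (a : ℝ) ≠ 0 := NeZero.ne _
  have ha0 : (0 : ℝ) < a := by positivity
  -- Modulo `1` the points `x + i/a` are a permutation of the points `y + i/a`. The latter all lie
  -- in `[0, 1)`, where the polynomial multiplication formula applies; the correction at `0` can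
  -- occur only for `i = 0`.
  set y : ℝ := Int.fract (a * x) / a with hy
  have hy0 : 0 ≤ y := div_nonneg (Int.fract_nonneg _) ha0.le
  have hay : a * y = Int.fract (a * x) := by rw [hy]; field_simp
  have hy1 : a * y < 1 := by rw [hay]; exact Int.fract_lt_one _
  have hx : ∀ i : ℕ, x + i / a = y + ((i + ⌊a * x⌋ : ℤ) : ℝ) / a := fun i => by
    rw [hy, Int.fract]; push_cast; field_simp; ring
  have h1 : ∑ i ∈ range a, bernoulliBar k (x + i / a) =
      ∑ i ∈ range a, bernoulliBar k (y + i / a) := by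
    have hp : Function.Periodic (fun i : ℤ => bernoulliBar k (y + i / a)) (a : ℤ) := by
      simpa using bernoulliBar_intCast_div_periodic k a y 1
    have := sum_range_periodic_shift a hp ⌊a * x⌋
    simp only [hx]
    simpa using this
  have h2 : ∀ i ∈ range a, bernoulliBar k (y + i / a) = bernoulliFun k (y + i / a) +
      if k = 1 ∧ y = 0 ∧ i = 0 then 1 / 2 else 0 := fun i hi => by
    have hi' : (i : ℝ) + 1 ≤ a := by exact_mod_cast mem_range.1 hi
    have hpos : 0 ≤ (i : ℝ) / a := by positivity
    rw [bernoulliBar_of_mem_Ico (by positivity)]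
    · have : y + (i : ℝ) / a = 0 ↔ y = 0 ∧ i = 0 := by
        rw [add_eq_zero_iff_of_nonneg hy0 hpos]
        simp [ha]
      simp only [this]
    · have : y + (i : ℝ) / a = (a * y + i) / a := by field_simp
      rw [this, div_lt_one ha0]; linarith
  rw [h1, sum_congr rfl h2, sum_add_distrib, mul_add, ← bernoulliBar_fract, ← hay,
    bernoulliBar_of_mem_Ico (by positivity) hy1, bernoulliFun_mul k (NeZero.ne a) y]
  have h3 : ∑ i ∈ range a, (if k = 1 ∧ y = 0 ∧ i = 0 then (1 / 2 : ℝ) else 0) =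
      if k = 1 ∧ y = 0 then 1 / 2 else 0 := by
    by_cases h : k = 1 ∧ y = 0
    · simp [h.1, h.2, Finset.sum_ite_eq', Nat.pos_of_ne_zero (NeZero.ne a)]
    · rw [if_neg h]
      exact sum_eq_zero fun i _ => if_neg fun h' => h ⟨h'.1, h'.2.1⟩
  rw [h3, mul_add]
  congr 1
  · field_simp
  · simp only [mul_eq_zero, ha, false_or]
    split_ifs with h
    · rw [h.1, pow_one]
    · simp

/-! ### The product formula for Bernoulli polynomials. -/

/-- The normalized Bernoulli polynomial function `B_k(x) / k!`. -/
noncomputable def bernoulliDiv (k : ℕ) (x : ℝ) : ℝ := bernoulliFun k x / k.factorial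

@[simp]
theorem bernoulliDiv_zero (x : ℝ) : bernoulliDiv 0 x = 1 := by simp [bernoulliDiv]

theorem hasDerivAt_bernoulliDiv (k : ℕ) (x : ℝ) :
    HasDerivAt (bernoulliDiv (k + 1)) (bernoulliDiv k x) x := by
  have h := (hasDerivAt_bernoulliFun (k + 1) x).div_const ((k + 1).factorial : ℝ)
  refine HasDerivAt.congr_deriv (f := bernoulliDiv (k + 1)) h ?_
  rw [bernoulliDiv]
  rw [Nat.factorial_succ, Nat.add_sub_cancel]
  have : (k.factorial : ℝ) ≠ 0 := by positivity
  push_cast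
  field_simp

theorem continuous_bernoulliDiv (k : ℕ) : Continuous (bernoulliDiv k) :=
  (continuous_bernoulliFun k).div_const _

theorem bernoulliDiv_one (x : ℝ) : bernoulliDiv 1 x = x - 1 / 2 := by simp [bernoulliDiv]

theorem bernoulliDiv_endpoints {k : ℕ} (hk : k ≠ 1) : bernoulliDiv k 1 = bernoulliDiv k 0 := by
  simp [bernoulliDiv, bernoulliFun_endpoints_eq_of_ne_one hk]

theorem integral_bernoulliDiv_succ (k : ℕ) : ∫ y in (0 : ℝ)..1, bernoulliDiv (k + 1) y = 0 := by
  simp only [bernoulliDiv]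
  rw [intervalIntegral.integral_div, integral_bernoulliFun_eq_zero (Nat.succ_ne_zero k), zero_div]

theorem integral_bernoulliDiv_by_parts (m n : ℕ) :
    (∫ y in (0 : ℝ)..1, bernoulliDiv m y * bernoulliDiv (n + 1) y) +
      ∫ y in (0 : ℝ)..1, bernoulliDiv (m + 1) y * bernoulliDiv n y =
    bernoulliDiv (m + 1) 1 * bernoulliDiv (n + 1) 1 -
      bernoulliDiv (m + 1) 0 * bernoulliDiv (n + 1) 0 := by
  have hi (i j : ℕ) : IntervalIntegrable (fun y => bernoulliDiv i y * bernoulliDiv j y)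
      MeasureTheory.volume 0 1 :=
    ((continuous_bernoulliDiv i).mul (continuous_bernoulliDiv j)).intervalIntegrable _ _
  rw [← intervalIntegral.integral_add (hi _ _) (hi _ _)]
  exact intervalIntegral.integral_eq_sub_of_hasDerivAt
    (fun y _ => (hasDerivAt_bernoulliDiv m y).mul (hasDerivAt_bernoulliDiv n y))
    ((hi _ _).add (hi _ _))

/-- Repeated integration by parts. The boundary terms cancel as long as both indices exceed `1`; the
value comes from the last step, where `B_1(1) - B_1(0) = 1`. -/
theorem integral_bernoulliDiv_mul (m n : ℕ) :
    ∫ y in (0 : ℝ)..1, bernoulliDiv (m + 1) y * bernoulliDiv (n + 1) y =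
      (-1) ^ n * bernoulliDiv (m + n + 2) 0 := by
  induction n generalizing m with
  | zero =>
    have h := integral_bernoulliDiv_by_parts (m + 1) 0
    simp only [bernoulliDiv_zero, mul_one, integral_bernoulliDiv_succ, add_zero, zero_add,
      bernoulliDiv_one] at h
    rw [bernoulliDiv_endpoints (by lia)] at h
    simp only [zero_add, bernoulliDiv_one]
    rw [h]; ring
  | succ n ih =>
    have h := integral_bernoulliDiv_by_parts (m + 1) (n + 1)
    rw [ih (m + 1), bernoulliDiv_endpoints (by lia), bernoulliDiv_endpoints (by lia),
      sub_self] at h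
    rw [show m + (n + 1) + 2 = m + 1 + n + 2 by ring]
    rw [eq_neg_of_add_eq_zero_left h]; ring

/-- The coefficients `binom (i - 1) (n - 1)`, where `binom (-1) k = (-1) ^ k`. -/
def leftCoeff : ℕ → ℕ → ℝ
  | _, 0 => 0
  | 0, n + 1 => (-1) ^ n
  | i + 1, n + 1 => (i.choose n : ℝ)

/-- The coefficients `binom (i - 1) (n - 1)`, where `binom (-1) k = 0` for `k ≠ -1`. -/
def rightCoeff : ℕ → ℕ → ℝ
  | 0, 0 => 1
  | _ + 1, 0 => 0
  | 0, _ + 1 => 0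
  | i + 1, n + 1 => (i.choose n : ℝ)

/-- Pascal's rule persists at `i = 0` under both conventions for `binom (-1) k`, and it is what
makes `productExpansion` differentiate like a product. At `i = 0` the two terms of the expansion are
multiples of the same function of `s`, so one convention carries the whole coefficient there when
both indices are positive. -/
theorem leftCoeff_succ_succ (i n : ℕ) :
    leftCoeff (i + 1) (n + 1) = leftCoeff i (n + 1) + leftCoeff i n := by
  rcases i with _ | i <;> rcases n with _ | n <;>
    simp [leftCoeff, Nat.choose_succ_succ, pow_succ, add_comm]

theorem rightCoeff_succ_succ (i n : ℕ) :
    rightCoeff (i + 1) (n + 1) = rightCoeff i (n + 1) + rightCoeff i n := by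
  rcases i with _ | i <;> rcases n with _ | n <;>
    simp [rightCoeff, Nat.choose_succ_succ, add_comm]

theorem rightCoeff_of_lt {i n : ℕ} (h : i < n) : rightCoeff i n = 0 := by
  obtain ⟨n, rfl⟩ := Nat.exists_eq_succ_of_ne_zero (by lia : n ≠ 0)
  rcases i with _ | i
  · rfl
  · simp [rightCoeff, Nat.choose_eq_zero_of_lt (by lia : i < n)]

/-- The expansion of `B_m(y + s) B_n(y) / (m! n!)` into products with one factor `B_j(s)`. -/
noncomputable def productExpansion (m n : ℕ) (s y : ℝ) : ℝ :=
  ∑ p ∈ antidiagonal (m + n), bernoulliDiv p.2 s *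
    (leftCoeff p.1 n * bernoulliDiv p.1 y +
      (-1) ^ p.2 * (rightCoeff p.1 m * bernoulliDiv p.1 (y + s)))

theorem productExpansion_zero_left (n : ℕ) (s y : ℝ) :
    productExpansion 0 n s y = bernoulliDiv n y := by
  rcases n with _ | n
  · simp [productExpansion, leftCoeff, rightCoeff]
  · rw [productExpansion, zero_add, Finset.Nat.sum_antidiagonal_succ,
      sum_eq_single (n, 0)]
    · simp [leftCoeff, rightCoeff, pow_succ]
    · rintro ⟨i, j⟩ hp hne
      have hij : i + j = n := by simpa using hp
      have : i < n := by
        rcases j with _ | j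
        · exact absurd (by simpa using hij) fun h => hne (by rw [h])
        · lia
      simp [leftCoeff, rightCoeff, Nat.choose_eq_zero_of_lt this]
    · simp

theorem productExpansion_zero_right (m : ℕ) (s y : ℝ) :
    productExpansion m 0 s y = bernoulliDiv m (y + s) := by
  rw [productExpansion, add_zero, sum_eq_single (m, 0)]
  · rcases m with _ | m <;> simp [leftCoeff, rightCoeff]
  · rintro ⟨i, j⟩ hp hne
    have hij : i + j = m := by simpa using hp
    have : i < m := by
      rcases j with _ | j
      · exact absurd (by simpa using hij) fun h => hne (by rw [h])
      · lia
    rw [rightCoeff_of_lt this]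
    simp [leftCoeff]
  · simp

theorem hasDerivAt_productExpansion_right (m n : ℕ) (s y : ℝ) :
    HasDerivAt (fun y => productExpansion (m + 1) (n + 1) s y)
      (productExpansion m (n + 1) s y + productExpansion (m + 1) n s y) y := by
  have h (i j : ℕ) : HasDerivAt (fun y => bernoulliDiv j s *
      (leftCoeff (i + 1) (n + 1) * bernoulliDiv (i + 1) y +
      (-1) ^ j * (rightCoeff (i + 1) (m + 1) * bernoulliDiv (i + 1) (y + s))))
      (bernoulliDiv j s * (leftCoeff (i + 1) (n + 1) * bernoulliDiv i y +
      (-1) ^ j * (rightCoeff (i + 1) (m + 1) * bernoulliDiv i (y + s)))) y :=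
    (((hasDerivAt_bernoulliDiv i y).const_mul _).add
      ((((hasDerivAt_bernoulliDiv i (y + s)).comp_add_const y s).const_mul _).const_mul
        _)).const_mul _
  simp only [productExpansion]
  rw [show m + 1 + (n + 1) = m + n + 1 + 1 by ring, show m + (n + 1) = m + n + 1 by ring,
    show m + 1 + n = m + n + 1 by ring, ← sum_add_distrib]
  simp only [Finset.Nat.sum_antidiagonal_succ (n := m + n + 1)]
  simp only [bernoulliDiv_zero]
  refine ((HasDerivAt.fun_sum fun p (_ : p ∈ antidiagonal (m + n + 1)) =>
    h p.1 p.2).const_add _).congr_deriv ?_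
  exact sum_congr rfl fun p _ => by rw [leftCoeff_succ_succ, rightCoeff_succ_succ]; ring

/-- In the left part only `B_j(s)` depends on `s`. In the right part the two product-rule terms
carry opposite signs because of `(-1) ^ j`, and Pascal's rule merges them. -/
theorem hasDerivAt_productExpansion_left (m n : ℕ) (s y : ℝ) :
    HasDerivAt (fun s => productExpansion (m + 1) n s y) (productExpansion m n s y) s := by
  have h1 (i j : ℕ) : HasDerivAt (fun s => bernoulliDiv (j + 1) s * (leftCoeff i n * bernoulliDiv i y))
      (bernoulliDiv j s * (leftCoeff i n * bernoulliDiv i y)) s :=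
    (hasDerivAt_bernoulliDiv j s).mul_const _
  have h2 (k : ℕ) : HasDerivAt (fun s => ∑ p ∈ antidiagonal (k + 1), bernoulliDiv p.2 s *
      ((-1) ^ p.2 * (rightCoeff p.1 (m + 1) * bernoulliDiv p.1 (y + s))))
      (∑ p ∈ antidiagonal k, bernoulliDiv p.2 s *
        ((-1) ^ p.2 * (rightCoeff p.1 m * bernoulliDiv p.1 (y + s)))) s := by
    have hb (i : ℕ) : HasDerivAt (fun s => bernoulliDiv i (y + s))
        (if i = 0 then 0 else bernoulliDiv (i - 1) (y + s)) s := by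
      rcases i with _ | i
      · simpa using hasDerivAt_const s (1 : ℝ)
      · simpa using (hasDerivAt_bernoulliDiv i (y + s)).comp_const_add y s
    have hb' (i : ℕ) : HasDerivAt (fun s => bernoulliDiv i s)
        (if i = 0 then 0 else bernoulliDiv (i - 1) s) s := by
      rcases i with _ | i
      · simpa using hasDerivAt_const s (1 : ℝ)
      · simpa using hasDerivAt_bernoulliDiv i s
    have h := HasDerivAt.fun_sum fun p (_ : p ∈ antidiagonal (k + 1)) =>
      (hb' p.2).mul ((((hb p.1).const_mul (rightCoeff p.1 (m + 1))).const_mul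
        ((-1 : ℝ) ^ p.2)))
    convert! h using 1
    rw [sum_add_distrib, Finset.Nat.sum_antidiagonal_succ', add_comm,
      Finset.Nat.sum_antidiagonal_succ (f := fun p => bernoulliDiv p.2 s * _)]
    simp only [if_true, mul_zero, zero_mul, zero_add, Nat.succ_ne_zero, if_false,
      Nat.add_sub_cancel]
    rw [← sum_add_distrib]
    exact sum_congr rfl fun p _ => by rw [rightCoeff_succ_succ]; ring
  simp only [productExpansion, mul_add, sum_add_distrib]
  rw [show m + 1 + n = m + n + 1 by ring]
  refine HasDerivAt.add ?_ (h2 _)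
  simp only [Finset.Nat.sum_antidiagonal_succ' (n := m + n)]
  simp only [bernoulliDiv_zero]
  exact (HasDerivAt.fun_sum fun p (_ : p ∈ antidiagonal (m + n)) => h1 p.1 p.2).const_add _

/-- Induction on `m + n`: both sides have the same partial derivatives by the inductive hypothesis,
so they differ by a constant, which is identified by integrating over a period at `s = 0`. -/
theorem productExpansion_eq (m n : ℕ) (s y : ℝ) :
    productExpansion m n s y = bernoulliDiv m (y + s) * bernoulliDiv n y := by
  induction h : m + n generalizing m n s y with
  | zero =>
    obtain ⟨rfl, rfl⟩ : m = 0 ∧ n = 0 := by lia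
    simp [productExpansion_zero_left]
  | succ N ih =>
    rcases m with _ | m
    · simp [productExpansion_zero_left]
    rcases n with _ | n
    · simp [productExpansion_zero_right]
    set F : ℝ → ℝ → ℝ := fun s y =>
      productExpansion (m + 1) (n + 1) s y - bernoulliDiv (m + 1) (y + s) * bernoulliDiv (n + 1) y
    have hy (s y : ℝ) : HasDerivAt (F s) 0 y := by
      refine ((hasDerivAt_productExpansion_right m n s y).sub
        (((hasDerivAt_bernoulliDiv m (y + s)).comp_add_const y s).mul
          (hasDerivAt_bernoulliDiv n y))).congr_deriv ?_
      rw [ih m (n + 1) s y (by lia), ih (m + 1) n s y (by lia)]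
      ring
    have hs (s y : ℝ) : HasDerivAt (fun s => F s y) 0 s := by
      refine ((hasDerivAt_productExpansion_left m (n + 1) s y).sub
        (((hasDerivAt_bernoulliDiv m (y + s)).comp_const_add y s).mul_const _)).congr_deriv ?_
      rw [ih m (n + 1) s y (by lia)]
      ring
    have hcy (s y : ℝ) : F s y = F s 0 :=
      is_const_of_deriv_eq_zero (fun y => (hy s y).differentiableAt) (fun y => (hy s y).deriv) y 0
    have hcs (s y : ℝ) : F s y = F 0 y :=
      is_const_of_deriv_eq_zero (fun s => (hs s y).differentiableAt) (fun s => (hs s y).deriv) s 0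
    have hint : ∫ y in (0 : ℝ)..1, F 0 y = 0 := by
      simp only [F, productExpansion, add_zero]
      have hc (i : ℕ) : Continuous (bernoulliDiv i) := continuous_bernoulliDiv i
      rw [intervalIntegral.integral_sub, intervalIntegral.integral_finsetSum,
        integral_bernoulliDiv_mul]
      · rw [show m + 1 + (n + 1) = m + n + 1 + 1 by ring, Finset.Nat.sum_antidiagonal_succ]
        -- Only the `i = 0` term survives integration. Its coefficient `(-1) ^ n` is the sign in
        -- `integral_bernoulliDiv_mul`, which explains the value of `leftCoeff` at `0`.
        have hz : ∀ p ∈ antidiagonal (m + n + 1), ∫ y in (0 : ℝ)..1, bernoulliDiv p.2 0 *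
            (leftCoeff (p.1 + 1) (n + 1) * bernoulliDiv (p.1 + 1) y +
              (-1) ^ p.2 * (rightCoeff (p.1 + 1) (m + 1) * bernoulliDiv (p.1 + 1) y)) = 0 := by
          intro p _
          rw [show (fun y => bernoulliDiv p.2 0 *
            (leftCoeff (p.1 + 1) (n + 1) * bernoulliDiv (p.1 + 1) y +
              (-1) ^ p.2 * (rightCoeff (p.1 + 1) (m + 1) * bernoulliDiv (p.1 + 1) y))) =
            fun y => (bernoulliDiv p.2 0 * (leftCoeff (p.1 + 1) (n + 1) +
              (-1) ^ p.2 * rightCoeff (p.1 + 1) (m + 1))) * bernoulliDiv (p.1 + 1) y by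
              ext y; ring,
            intervalIntegral.integral_const_mul, integral_bernoulliDiv_succ, mul_zero]
        rw [sum_eq_zero hz]
        simp [leftCoeff, rightCoeff]
        ring
      · intro p _
        exact Continuous.intervalIntegrable (by fun_prop) _ _
      · exact Continuous.intervalIntegrable (by fun_prop) _ _
      · exact Continuous.intervalIntegrable (by fun_prop) _ _
    have h0 : F 0 0 = 0 := by
      have hc : ∫ y in (0 : ℝ)..1, F 0 y = ∫ _ in (0 : ℝ)..1, F 0 0 :=
        intervalIntegral.integral_congr fun y _ => hcy 0 y
      simpa [hint] using hc.symm
    have := hcs s y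
    rw [hcy 0 y, h0] at this
    exact sub_eq_zero.1 this

/-! ### The product formula for Bernoulli functions. -/

/-- The normalized Bernoulli function `B̄_k(x) / k!`. -/
noncomputable def bernoulliBarDiv (k : ℕ) (x : ℝ) : ℝ := bernoulliBar k x / k.factorial

@[simp]
theorem bernoulliBarDiv_zero (x : ℝ) : bernoulliBarDiv 0 x = 1 := by simp [bernoulliBarDiv]

theorem bernoulliBarDiv_fract (k : ℕ) (x : ℝ) :
    bernoulliBarDiv k (Int.fract x) = bernoulliBarDiv k x := by
  simp [bernoulliBarDiv, bernoulliBar_fract]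

theorem bernoulliBarDiv_add_int (k : ℕ) (x : ℝ) (c : ℤ) :
    bernoulliBarDiv k (x + c) = bernoulliBarDiv k x := by
  simp [bernoulliBarDiv, bernoulliBar_add_int]

theorem bernoulliBarDiv_neg (k : ℕ) (x : ℝ) :
    bernoulliBarDiv k (-x) = (-1) ^ k * bernoulliBarDiv k x := by
  rw [bernoulliBarDiv, bernoulliBar_neg, bernoulliBarDiv, mul_div_assoc]

theorem bernoulliBarDiv_of_mem_Ico {k : ℕ} {x : ℝ} (h0 : 0 ≤ x) (h1 : x < 1) :
    bernoulliBarDiv k x = bernoulliDiv k x + if k = 1 then (if x = 0 then 1 / 2 else 0) else 0 := by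
  rw [bernoulliBarDiv, bernoulliBar_of_mem_Ico h0 h1, add_div, bernoulliDiv]
  congr 1
  by_cases hk : k = 1
  · subst hk; simp
  · simp [hk]

theorem bernoulliDiv_zero_of_ne_one {k : ℕ} (hk : k ≠ 1) :
    (-1) ^ k * bernoulliDiv k 0 = bernoulliDiv k 0 := by
  have h := @bernoulliFun_eval_one_sub k 0
  rw [sub_zero, bernoulliFun_endpoints_eq_of_ne_one hk] at h
  rw [bernoulliDiv, ← mul_div_assoc, ← h]

/-- The analogue of `productExpansion` for Bernoulli functions. -/
noncomputable def barExpansion (m n : ℕ) (x y : ℝ) : ℝ :=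
  ∑ p ∈ antidiagonal (m + n), bernoulliBarDiv p.2 (x - y) *
    (leftCoeff p.1 n * bernoulliBarDiv p.1 y +
      (-1) ^ p.2 * (rightCoeff p.1 m * bernoulliBarDiv p.1 x))

theorem barExpansion_swap {m n : ℕ} (hm : 0 < m) (hn : 0 < n) (x y : ℝ) :
    barExpansion m n x y = barExpansion n m y x := by
  obtain ⟨m, rfl⟩ := Nat.exists_eq_succ_of_ne_zero hm.ne'
  obtain ⟨n, rfl⟩ := Nat.exists_eq_succ_of_ne_zero hn.ne'
  rw [barExpansion, barExpansion, add_comm n.succ, ← neg_sub x y]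
  simp only [bernoulliBarDiv_neg]
  rw [show m.succ + n.succ = m + n + 1 + 1 by lia,
    Finset.Nat.sum_antidiagonal_succ (n := m + n + 1),
    Finset.Nat.sum_antidiagonal_succ (n := m + n + 1)]
  have hsq (k : ℕ) : ((-1 : ℝ) ^ k) * (-1) ^ k = 1 := by
    rw [← mul_pow]; simp
  congr 1
  · have h : (-1 : ℝ) ^ n = (-1) ^ (m + n + 1 + 1) * (-1) ^ m := by
      rw [show m + n + 1 + 1 = m + (n + 2) by ring, pow_add, mul_right_comm, hsq, pow_add]
      simp
    simp only [leftCoeff, rightCoeff, bernoulliBarDiv_zero]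
    rw [h]; ring
  · refine sum_congr rfl fun p _ => ?_
    simp only [leftCoeff, rightCoeff]
    linear_combination (-(((p.1.choose n : ℕ) : ℝ) * bernoulliBarDiv (p.1 + 1) y *
      bernoulliBarDiv p.2 (x - y))) * hsq p.2

theorem sum_antidiagonal_ite_snd {N : ℕ} (h : ℕ × ℕ → ℝ) :
    (∑ p ∈ antidiagonal (N + 1), if p.2 = 1 then h p else 0) = h (N, 1) := by
  rw [sum_eq_single (N, 1)]
  · simp
  · rintro ⟨i, j⟩ hp hne
    have hij : i + j = N + 1 := by simpa using hp
    exact if_neg fun hj : j = 1 => hne (by rw [hj, show i = N by lia])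
  · simp

theorem sum_antidiagonal_ite_fst {N : ℕ} (h : ℕ × ℕ → ℝ) :
    (∑ p ∈ antidiagonal (N + 1), if p.1 = 1 then h p else 0) = h (1, N) := by
  rw [sum_eq_single (1, N)]
  · simp
  · rintro ⟨i, j⟩ hp hne
    have hij : i + j = N + 1 := by simpa using hp
    exact if_neg fun hj : i = 1 => hne (by rw [hj, show j = N by lia])
  · simp [add_comm]

/-- Here `x`, `y` and `x - y` all lie in `[0, 1)`, so each Bernoulli function is its polynomial up
to the correction of `B̄_1` at `0`. The corrections match on both sides except when both orders are
`1` and `x = y = 0`; that `1/4` is the source of the Kronecker delta term in `C₁`. -/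
theorem barExpansion_of_le {m n : ℕ} {x y : ℝ} (hy : 0 ≤ y) (hyx : y ≤ x)
    (hx : x < 1) :
    barExpansion (m + 1) (n + 1) x y = bernoulliBarDiv (m + 1) x * bernoulliBarDiv (n + 1) y +
      if m = 0 ∧ n = 0 ∧ x = 0 ∧ y = 0 then 1 / 4 else 0 := by
  set δ : ℝ → ℝ := fun u => if u = 0 then 1 / 2 else 0 with hδ
  have hb (k : ℕ) (u : ℝ) (h0 : 0 ≤ u) (h1 : u < 1) :
      bernoulliBarDiv k u = bernoulliDiv k u + if k = 1 then δ u else 0 :=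
    bernoulliBarDiv_of_mem_Ico h0 h1
  have hexp : barExpansion (m + 1) (n + 1) x y =
      productExpansion (m + 1) (n + 1) (x - y) y +
      (∑ p ∈ antidiagonal (m + n + 1 + 1), if p.2 = 1 then δ (x - y) *
        (leftCoeff p.1 (n + 1) * bernoulliBarDiv p.1 y -
          rightCoeff p.1 (m + 1) * bernoulliBarDiv p.1 x) else 0) +
      ∑ p ∈ antidiagonal (m + n + 1 + 1), if p.1 = 1 then bernoulliDiv p.2 (x - y) *
        (leftCoeff p.1 (n + 1) * δ y + (-1) ^ p.2 * (rightCoeff p.1 (m + 1) * δ x)) else 0 := by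
    rw [barExpansion, productExpansion, show m + 1 + (n + 1) = m + n + 1 + 1 by ring,
      ← sum_add_distrib, ← sum_add_distrib]
    refine sum_congr rfl fun p _ => ?_
    rw [hb p.2 (x - y) (by linarith) (by linarith), hb p.1 y hy (by linarith),
      hb p.1 x (by linarith) hx, add_sub_cancel]
    by_cases h2 : p.2 = 1 <;> by_cases h1 : p.1 = 1 <;> simp [h1, h2] <;> ring
  rw [hexp, productExpansion_eq, sum_antidiagonal_ite_snd, sum_antidiagonal_ite_fst,
    add_sub_cancel, hb (m + 1) x (by linarith) hx, hb (n + 1) y hy (by linarith)]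
  -- The correction to `B̄_1(x - y)` is nonzero only for `x = y`, and then the bracket vanishes
  -- because `binom (m + n) n = binom (m + n) m`.
  have hz : δ (x - y) * (leftCoeff (m + n + 1) (n + 1) * bernoulliBarDiv (m + n + 1) y -
      rightCoeff (m + n + 1) (m + 1) * bernoulliBarDiv (m + n + 1) x) = 0 := by
    by_cases hxy : x = y
    · subst hxy
      simp only [leftCoeff, rightCoeff]
      rw [Nat.choose_symm_add]
      ring
    · simp [hδ, sub_eq_zero, hxy]
  simp only [hz, add_zero]
  have hl : leftCoeff 1 (n + 1) = if n = 0 then 1 else 0 := by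
    rcases n with _ | n <;> simp [leftCoeff]
  have hr : rightCoeff 1 (m + 1) = if m = 0 then 1 else 0 := by
    rcases m with _ | m <;> simp [rightCoeff]
  rw [hl, hr]
  rcases eq_or_ne y 0 with rfl | hy0
  · by_cases hn : n = 0
    · subst hn
      by_cases hm : m = 0
      · subst hm
        by_cases hx0 : x = 0
        · subst hx0
          norm_num [hδ, bernoulliDiv_one]
        · simp [hδ, hx0, bernoulliDiv_one]
      · simp [hδ, hm, bernoulliDiv_one]
    · by_cases hm : m = 0
      · subst hm
        by_cases hx0 : x = 0
        · subst hx0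
          have := bernoulliDiv_zero_of_ne_one (k := n + 1) (by lia)
          simp [hδ, hn] at this ⊢
          linear_combination (1 / 2) * this
        · simp [hδ, hx0, hn]
      · simp [hn, hm]
  · have hx0 : x ≠ 0 := by
      rintro rfl
      exact hy0 (le_antisymm hyx hy)
    simp [hδ, hx0, hy0]

theorem barExpansion_fract (m n : ℕ) (x y : ℝ) :
    barExpansion m n (Int.fract x) (Int.fract y) = barExpansion m n x y := by
  have h (k : ℕ) : bernoulliBarDiv k (Int.fract x - Int.fract y) = bernoulliBarDiv k (x - y) := by
    rw [← bernoulliBarDiv_add_int k (x - y) (⌊y⌋ - ⌊x⌋), Int.fract, Int.fract]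
    push_cast; ring_nf
  simp only [barExpansion, h, bernoulliBarDiv_fract]

/-- The product formula for Bernoulli functions. -/
theorem barExpansion_eq {m n : ℕ} (hm : 0 < m) (hn : 0 < n) (x y : ℝ) :
    barExpansion m n x y = bernoulliBarDiv m x * bernoulliBarDiv n y +
      if m = 1 ∧ n = 1 ∧ Int.fract x = 0 ∧ Int.fract y = 0 then 1 / 4 else 0 := by
  -- The polynomial identity needs the difference of fractional parts in `[0, 1)`; the symmetry
  -- `barExpansion_swap` supplies the other case.
  wlog h : Int.fract y ≤ Int.fract x generalizing m n x y
  · rw [barExpansion_swap hm hn, this hn hm y x (le_of_not_ge h), mul_comm]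
    congr 2
    simp only [eq_iff_iff]
    tauto
  obtain ⟨m, rfl⟩ := Nat.exists_eq_succ_of_ne_zero hm.ne'
  obtain ⟨n, rfl⟩ := Nat.exists_eq_succ_of_ne_zero hn.ne'
  rw [← barExpansion_fract, Nat.succ_eq_add_one, Nat.succ_eq_add_one,
    barExpansion_of_le (Int.fract_nonneg y) h (Int.fract_lt_one x),
    bernoulliBarDiv_fract, bernoulliBarDiv_fract]
  simp

/-! ### Reciprocity for generalized Dedekind sums. -/

theorem bernoulliBarDiv_intCast_div_periodic (k a : ℕ) [NeZero a] (x : ℝ) (c : ℤ) :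
    Function.Periodic (fun i : ℤ => bernoulliBarDiv k (x + c * i / a)) (a : ℤ) := fun i => by
  have := bernoulliBar_intCast_div_periodic k a x c i
  simp only at this
  simp only [bernoulliBarDiv, this]

theorem sum_bernoulliBarDiv_add_div (k a : ℕ) [NeZero a] (x : ℝ) :
    ∑ i ∈ range a, bernoulliBarDiv k (x + i / a) = a / a ^ k * bernoulliBarDiv k (a * x) := by
  have ha : (a : ℝ) ^ k ≠ 0 := pow_ne_zero _ (NeZero.ne _)
  simp only [bernoulliBarDiv]
  rw [← sum_div, div_mul_div_comm, ← sum_bernoulliBar_add_div, mul_div_mul_left _ _ ha]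

theorem sum_bernoulliBarDiv_sub_div (k a : ℕ) [NeZero a] (x : ℝ) :
    ∑ i ∈ range a, bernoulliBarDiv k (x - i / a) = a / a ^ k * bernoulliBarDiv k (a * x) := by
  have h := sum_range_periodic_neg a (bernoulliBarDiv_intCast_div_periodic k a x 1)
  rw [← sum_bernoulliBarDiv_add_div]
  simpa [neg_div, ← sub_eq_add_neg] using h

/-- The generalized Dedekind sum of Bernoulli functions of orders `m` and `n`. -/
noncomputable def dedekindSum (m n a b e : ℕ) : ℝ :=
  ∑ h ∈ range e, bernoulliBarDiv m (a * h / e) * bernoulliBarDiv n (b * h / e)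

/-- Ensures that the exceptional `1/4` of the product formula is counted exactly once in the triple
sum. -/
theorem fract_div_sub_div_eq_zero {a e h i : ℕ} (he : h < e) (hi : i < a)
    (hae : a.Coprime e) (hf : Int.fract ((h : ℝ) / e - i / a) = 0) : h = 0 ∧ i = 0 := by
  have he0 : (e : ℝ) ≠ 0 := by exact_mod_cast (by lia : e ≠ 0)
  have ha0 : (a : ℝ) ≠ 0 := by exact_mod_cast (by lia : a ≠ 0)
  obtain ⟨c, hc⟩ := Int.fract_eq_zero_iff.1 hf
  have h1 : (h : ℤ) * a - i * e = c * e * a := by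
    have : (h : ℝ) * a - i * e = c * e * a := by rw [hc]; field_simp
    exact_mod_cast this
  have h2 : (e : ℤ) ∣ h * a := ⟨c * a + i, by linear_combination h1⟩
  have h3 : e ∣ h := hae.symm.dvd_of_dvd_mul_right (by exact_mod_cast h2)
  have h0 : h = 0 := Nat.eq_zero_of_dvd_of_lt h3 he
  subst h0
  refine ⟨rfl, Nat.eq_zero_of_dvd_of_lt ?_ hi⟩
  have he' : (e : ℤ) ≠ 0 := by exact_mod_cast (by lia : e ≠ 0)
  have h4 : (i : ℤ) = a * (-c) :=
    mul_right_cancel₀ he' (by push_cast at h1; linear_combination -h1)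
  exact_mod_cast Dvd.intro _ h4.symm

theorem dedekindSum_reciprocity_aux {m n a b e : ℕ} [NeZero a] [NeZero b] [NeZero e] (hm : 0 < m)
    (hn : 0 < n) (hae : a.Coprime e) (hbe : b.Coprime e) :
    (a : ℝ) / a ^ m * (b / b ^ n) * dedekindSum m n a b e +
      (if m = 1 ∧ n = 1 then 1 / 4 else 0) =
    ∑ p ∈ antidiagonal (m + n), (e : ℝ) / e ^ p.1 * (-1) ^ p.1 *
      (leftCoeff p.1 n * (a / a ^ p.2) * dedekindSum p.2 p.1 a e b +
        rightCoeff p.1 m * (b / b ^ p.2) * dedekindSum p.2 p.1 b e a) := by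
  have hA : ∑ h ∈ range e, ∑ i ∈ range a, ∑ j ∈ range b,
      bernoulliBarDiv m ((h : ℝ) / e - i / a) * bernoulliBarDiv n ((h : ℝ) / e - j / b) =
      (a : ℝ) / a ^ m * (b / b ^ n) * dedekindSum m n a b e := by
    rw [dedekindSum, mul_sum]
    refine sum_congr rfl fun h _ => ?_
    rw [← sum_mul_sum, sum_bernoulliBarDiv_sub_div, sum_bernoulliBarDiv_sub_div, mul_div_assoc,
      mul_div_assoc]
    ring
  have hB : (∑ h ∈ range e, ∑ i ∈ range a, ∑ j ∈ range b,
      if m = 1 ∧ n = 1 ∧ Int.fract ((h : ℝ) / e - i / a) = 0 ∧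
        Int.fract ((h : ℝ) / e - j / b) = 0 then (1 / 4 : ℝ) else 0) =
      if m = 1 ∧ n = 1 then 1 / 4 else 0 := by
    by_cases hmn : m = 1 ∧ n = 1
    · have hpos (c : ℕ) [NeZero c] : 0 ∈ range c := mem_range.2 (Nat.pos_of_ne_zero (NeZero.ne c))
      rw [if_pos hmn, sum_eq_single_of_mem 0 (hpos e), sum_eq_single_of_mem 0 (hpos a),
        sum_eq_single_of_mem 0 (hpos b)]
      · simp [hmn.1, hmn.2]
      · exact fun j hj hj0 => if_neg fun h' =>
          hj0 (fract_div_sub_div_eq_zero (mem_range.1 (hpos e)) (mem_range.1 hj) hbe h'.2.2.2).2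
      · exact fun i hi hi0 => sum_eq_zero fun j _ => if_neg fun h' =>
          hi0 (fract_div_sub_div_eq_zero (mem_range.1 (hpos e)) (mem_range.1 hi) hae h'.2.2.1).2
      · exact fun h hh hh0 => sum_eq_zero fun i hi => sum_eq_zero fun j _ => if_neg fun h' =>
          hh0 (fract_div_sub_div_eq_zero (mem_range.1 hh) (mem_range.1 hi) hae h'.2.2.1).1
    · rw [if_neg hmn]
      exact sum_eq_zero fun h _ => sum_eq_zero fun i _ => sum_eq_zero fun j _ =>
        if_neg fun h' => hmn ⟨h'.1, h'.2.1⟩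
  rw [← hA, ← hB]
  simp only [← sum_add_distrib]
  simp only [← barExpansion_eq hm hn, barExpansion]
  -- Since `h` drops out of the difference, each term of the expansion has `h` in one factor only,
  -- and Raabe's formula applies to the sum over `h`.
  have hsub (h i j : ℕ) : (h : ℝ) / e - i / a - (h / e - j / b) = (j : ℝ) / b - i / a := by ring
  simp only [hsub]
  have hcomm (F : ℕ → ℕ → ℕ → ℕ × ℕ → ℝ) :
      ∑ h ∈ range e, ∑ i ∈ range a, ∑ j ∈ range b, ∑ p ∈ antidiagonal (m + n), F h i j p =
      ∑ p ∈ antidiagonal (m + n), ∑ h ∈ range e, ∑ i ∈ range a, ∑ j ∈ range b, F h i j p := by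
    simp only [sum_comm (t := antidiagonal (m + n))]
  rw [hcomm]
  refine sum_congr rfl fun p _ => ?_
  have hneg (c : ℕ) [NeZero c] (x : ℕ) : ∑ h ∈ range e, bernoulliBarDiv p.1 ((h : ℝ) / e - x / c) =
      e / e ^ p.1 * ((-1) ^ p.1 * bernoulliBarDiv p.1 (e * x / c)) := by
    have : ∀ h : ℕ, (h : ℝ) / e - x / c = -(x / c : ℝ) + h / e := fun h => by ring
    simp only [this]
    rw [sum_bernoulliBarDiv_add_div, mul_neg, bernoulliBarDiv_neg, mul_div_assoc]
  have h1 : ∑ h ∈ range e, ∑ i ∈ range a, ∑ j ∈ range b,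
      bernoulliBarDiv p.2 ((j : ℝ) / b - i / a) * bernoulliBarDiv p.1 ((h : ℝ) / e - j / b) =
      (e : ℝ) / e ^ p.1 * (-1) ^ p.1 * (a / a ^ p.2) * dedekindSum p.2 p.1 a e b := by
    rw [sum_comm]
    simp only [sum_comm (s := range e) (t := range b), ← mul_sum, hneg]
    rw [sum_comm]
    simp only [← sum_mul, sum_bernoulliBarDiv_sub_div]
    rw [dedekindSum, mul_sum]
    exact sum_congr rfl fun j _ => by rw [mul_div_assoc (a : ℝ)]; ring
  have h2 : ∑ h ∈ range e, ∑ i ∈ range a, ∑ j ∈ range b,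
      (-1) ^ p.2 * (bernoulliBarDiv p.2 ((j : ℝ) / b - i / a) *
        bernoulliBarDiv p.1 ((h : ℝ) / e - i / a)) =
      (e : ℝ) / e ^ p.1 * (-1) ^ p.1 * (b / b ^ p.2) * dedekindSum p.2 p.1 b e a := by
    rw [sum_comm]
    have h3 (i j : ℕ) : bernoulliBarDiv p.2 ((j : ℝ) / b - i / a) =
        (-1) ^ p.2 * bernoulliBarDiv p.2 ((i : ℝ) / a - j / b) := by
      rw [← bernoulliBarDiv_neg, neg_sub]
    have hsq : ((-1 : ℝ) ^ p.2) * (-1) ^ p.2 = 1 := by rw [← mul_pow]; simp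
    simp only [h3, ← mul_sum, ← sum_mul, hneg, sum_bernoulliBarDiv_sub_div]
    rw [dedekindSum, mul_sum, mul_sum]
    refine sum_congr rfl fun i _ => ?_
    rw [mul_div_assoc (b : ℝ)]
    linear_combination (b / b ^ p.2 * bernoulliBarDiv p.2 (b * (i / a)) *
      (e / e ^ p.1 * ((-1) ^ p.1 * bernoulliBarDiv p.1 (e * i / a)))) * hsq
  rw [mul_add]
  calc _ = leftCoeff p.1 n * (∑ h ∈ range e, ∑ i ∈ range a, ∑ j ∈ range b,
        bernoulliBarDiv p.2 ((j : ℝ) / b - i / a) * bernoulliBarDiv p.1 ((h : ℝ) / e - j / b)) +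
      rightCoeff p.1 m * (∑ h ∈ range e, ∑ i ∈ range a, ∑ j ∈ range b,
        (-1) ^ p.2 * (bernoulliBarDiv p.2 ((j : ℝ) / b - i / a) *
          bernoulliBarDiv p.1 ((h : ℝ) / e - i / a))) := by
        simp only [mul_sum, ← sum_add_distrib]
        refine sum_congr rfl fun h _ => sum_congr rfl fun i _ => sum_congr rfl fun j _ => ?_
        ring
    _ = _ := by rw [h1, h2]; ring

/-- With `g = gcd(a, b)`, the fractions `ah/b` run `g` times through the multiples of `g/b` modulo
`1`, and Raabe's formula at `0` sums them. This produces the power of the gcd and the Bernoulli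
number in `C₁`. -/
theorem dedekindSum_zero_right {N a b e : ℕ} [NeZero a] [NeZero b] :
    dedekindSum N 0 a e b =
      (Nat.gcd a b : ℝ) ^ N * (b / b ^ N) * bernoulliBarDiv N 0 := by
  obtain ⟨a', ha'⟩ := Nat.gcd_dvd_left a b
  obtain ⟨b', hb'⟩ := Nat.gcd_dvd_right a b
  have hg : 0 < Nat.gcd a b := Nat.gcd_pos_of_pos_left b (Nat.pos_of_ne_zero (NeZero.ne a))
  have hcop : a'.Coprime b' := by
    have h := Nat.coprime_div_gcd_div_gcd hg
    rwa [Nat.div_eq_of_eq_mul_right hg ha', Nat.div_eq_of_eq_mul_right hg hb'] at h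
  set g := Nat.gcd a b
  have hb0 : b' ≠ 0 := by
    rintro rfl
    exact NeZero.ne b (by simpa using hb')
  have : NeZero b' := ⟨hb0⟩
  have hgr : (g : ℝ) ≠ 0 := by exact_mod_cast hg.ne'
  have hbr : (b' : ℝ) ≠ 0 := by exact_mod_cast hb0
  have h1 : dedekindSum N 0 a e b = ∑ h ∈ range (g * b'), bernoulliBarDiv N (a' * (h : ℤ) / b') := by
    rw [dedekindSum, ← hb']
    refine sum_congr rfl fun h _ => ?_
    rw [bernoulliBarDiv_zero, mul_one]
    congr 1
    rw [ha', hb']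
    push_cast
    field_simp
  have hp := bernoulliBarDiv_intCast_div_periodic N b' 0 a'
  have hp1 := bernoulliBarDiv_intCast_div_periodic N b' 0 1
  simp only [zero_add, Int.cast_natCast, Int.cast_one, one_mul] at hp hp1
  rw [h1, sum_range_periodic_mul_period b' g hp]
  have h2 := sum_range_periodic_mul b' hp1 hcop
  have h3 := sum_bernoulliBarDiv_add_div N b' 0
  simp only [zero_add, mul_zero] at h3
  push_cast at h2 ⊢
  rw [h2, h3, nsmul_eq_mul, hb']
  push_cast
  rw [mul_pow]
  field_simp

/-- The contribution of a single divisor `d` to `R m n q a b`, without its Möbius factor. -/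
noncomputable def divisorTerm (m n a b d : ℕ) : ℝ :=
  n * (b : ℝ) ^ (n - 1) *
    ∑ j ∈ range (m + 1),
      (m.choose j : ℝ) * ((-1) ^ j * (a : ℝ) ^ (m - j) / ((m + n - j : ℕ) : ℝ)) *
        ∑ l ∈ Icc 1 b, bernoulliBar j ((a : ℝ) * l / b) *
          ((d : ℝ) ^ j * bernoulliBar (m + n - j) ((d : ℝ) * l / b))

theorem R_eq_sum_divisorTerm (m n q a b : ℕ) :
    R m n q a b = ∑ d ∈ q.divisors,
      (ArithmeticFunction.moebius (q / d) : ℝ) * divisorTerm m n a b d := by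
  simp only [R, divisorTerm, mul_sum]
  rw [sum_comm]
  simp only [sum_comm (t := q.divisors)]
  refine sum_congr rfl fun d _ => ?_
  rw [sum_comm' (t' := range (m + 1)) (s' := fun _ => Icc 1 b) (by simp [and_comm])]
  exact sum_congr rfl fun j _ => sum_congr rfl fun l _ => by ring

/-- Translates the coefficient of the product formula into the one appearing in `R`. -/
theorem factorial_mul_choose_div {m n k : ℕ} (hn : 0 < n) (hk : k ≤ m) :
    (m.factorial : ℝ) * n.factorial * ((m + n - k - 1).choose (n - 1) : ℝ) /
      (k.factorial * (m + n - k).factorial) = n * m.choose k / ((m + n - k : ℕ) : ℝ) := by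
  obtain ⟨r, rfl⟩ := Nat.exists_eq_add_of_le hk
  obtain ⟨n, rfl⟩ := Nat.exists_eq_succ_of_ne_zero hn.ne'
  have h1 := Nat.add_choose_mul_factorial_mul_factorial r n
  have h2 := Nat.add_choose_mul_factorial_mul_factorial k r
  rw [show k + r + n.succ - k = r + n + 1 by lia, Nat.succ_eq_add_one, Nat.add_sub_cancel,
    Nat.add_sub_cancel, Nat.factorial_succ, Nat.factorial_succ, ← h2, ← h1]
  rw [Nat.choose_symm_add (a := k) (b := r)]
  have h3 : (k.factorial : ℝ) ≠ 0 := by positivity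
  have h4 : (r.factorial : ℝ) ≠ 0 := by positivity
  have h5 : (n.factorial : ℝ) ≠ 0 := by positivity
  have h6 : ((r + n).choose n : ℝ) ≠ 0 := by
    exact_mod_cast (Nat.choose_pos (Nat.le_add_left n r)).ne'
  push_cast
  field_simp

theorem sum_rightCoeff_eq_divisorTerm {m n : ℕ} (hm : 0 < m) (hn : 0 < n) (a b e : ℕ) [NeZero a]
    [NeZero b] [NeZero e] :
    (m.factorial : ℝ) * n.factorial * (a ^ (m - 1) * b ^ (n - 1) * e ^ (m + n - 1)) *
      ∑ p ∈ antidiagonal (m + n), (e : ℝ) / e ^ p.1 * (-1) ^ p.1 *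
        (rightCoeff p.1 n * (a / a ^ p.2) * dedekindSum p.2 p.1 a e b) =
    (-1) ^ (m + n) * divisorTerm m n a b e := by
  have ha : (a : ℝ) ≠ 0 := NeZero.ne _
  have he : (e : ℝ) ≠ 0 := NeZero.ne _
  rw [← Finset.Nat.sum_antidiagonal_swap, Finset.Nat.sum_antidiagonal_eq_sum_range_succ_mk]
  simp only [Prod.fst_swap, Prod.snd_swap]
  have hsub : range (m + 1) ⊆ range (m + n).succ := range_subset_range.2 (by lia)
  -- With `k` the order of the factor free of `e`, `rightCoeff (m + n - k) n` vanishes for `k > m`;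
  -- this is why the sum in `R` stops at `m`.
  rw [← sum_subset hsub]
  · rw [divisorTerm, mul_sum, mul_sum, mul_sum]
    refine sum_congr rfl fun k hk => ?_
    have hkm : k ≤ m := Nat.lt_succ_iff.1 (mem_range.1 hk)
    have hD : ∑ l ∈ Icc 1 b, bernoulliBar k ((a : ℝ) * l / b) *
          ((e : ℝ) ^ k * bernoulliBar (m + n - k) ((e : ℝ) * l / b)) =
        e ^ k * (k.factorial * (m + n - k).factorial) * dedekindSum k (m + n - k) a e b := by
      have hp : Function.Periodic (fun l : ℤ => bernoulliBar k ((a : ℝ) * l / b) *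
          ((e : ℝ) ^ k * bernoulliBar (m + n - k) ((e : ℝ) * l / b))) (b : ℤ) := fun l => by
        have h1 := bernoulliBar_intCast_div_periodic k b 0 a l
        have h2 := bernoulliBar_intCast_div_periodic (m + n - k) b 0 e l
        simp only [zero_add, Int.cast_natCast] at h1 h2
        simp only [h1, h2]
      have h := sum_Icc_periodic b hp
      simp only [Int.cast_natCast] at h
      rw [h, dedekindSum, mul_sum]
      refine sum_congr rfl fun l _ => ?_
      rw [bernoulliBarDiv, bernoulliBarDiv]
      have h3 : (k.factorial : ℝ) ≠ 0 := by positivity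
      have h4 : ((m + n - k).factorial : ℝ) ≠ 0 := by positivity
      field_simp
    rw [hD]
    have hR : rightCoeff (m + n - k) n = ((m + n - k - 1).choose (n - 1) : ℝ) := by
      obtain ⟨N, hN⟩ := Nat.exists_eq_succ_of_ne_zero (by lia : m + n - k ≠ 0)
      obtain ⟨n, rfl⟩ := Nat.exists_eq_succ_of_ne_zero hn.ne'
      rw [hN]
      simp [rightCoeff]
    have hf := factorial_mul_choose_div (m := m) hn hkm
    have h3 : (k.factorial : ℝ) * (m + n - k).factorial ≠ 0 := by positivity
    have hpa : (a : ℝ) ^ (m - 1) * (a / a ^ k) = a ^ (m - k) := by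
      rw [← mul_div_assoc, ← pow_succ, Nat.sub_add_cancel hm, div_eq_iff (by positivity),
        ← pow_add, Nat.sub_add_cancel hkm]
    have hpe : (e : ℝ) ^ (m + n - 1) * (e / e ^ (m + n - k)) = e ^ k := by
      rw [← mul_div_assoc, ← pow_succ, Nat.sub_add_cancel (by lia), div_eq_iff (by positivity),
        ← pow_add, Nat.add_sub_cancel' (by lia)]
    have hs : (-1 : ℝ) ^ (m + n - k) = (-1) ^ (m + n) * (-1) ^ k := by
      have : (-1 : ℝ) ^ k * (-1) ^ k = 1 := by rw [← mul_pow]; simp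
      rw [← Nat.sub_add_cancel (by lia : k ≤ m + n), pow_add, mul_assoc, Nat.add_sub_cancel, this,
        mul_one]
    rw [hR, hs]
    rw [div_eq_iff h3] at hf
    set D := dedekindSum k (m + n - k) a e b
    calc _ = ((m.factorial : ℝ) * n.factorial * ((m + n - k - 1).choose (n - 1) : ℝ)) *
        ((a : ℝ) ^ (m - 1) * (a / a ^ k)) * ((e : ℝ) ^ (m + n - 1) * (e / e ^ (m + n - k))) *
          ((-1) ^ (m + n) * (-1) ^ k) * b ^ (n - 1) * D := by ring
      _ = _ := by rw [hf, hpa, hpe]; ring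
  · intro k _ hk
    have : m + n - k < n := by
      have : ¬ k < m + 1 := by simpa using hk
      lia
    rw [rightCoeff_of_lt this]
    simp

/-- The two conventions differ only at `i = 0`. The extra term is a Dedekind sum with one factor of
order `0`, evaluated by `dedekindSum_zero_right`. -/
theorem sum_leftCoeff_eq_sum_rightCoeff {N n : ℕ} (hn : 0 < n) (F : ℕ × ℕ → ℝ) :
    ∑ p ∈ antidiagonal (N + 1), leftCoeff p.1 n * F p =
      (∑ p ∈ antidiagonal (N + 1), rightCoeff p.1 n * F p) + (-1) ^ (n - 1) * F (0, N + 1) := by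
  obtain ⟨n, rfl⟩ := Nat.exists_eq_succ_of_ne_zero hn.ne'
  rw [Finset.Nat.sum_antidiagonal_succ, Finset.Nat.sum_antidiagonal_succ]
  simp [leftCoeff, rightCoeff]
  ring

/-- The sum `∑_{h mod e} B̄_m(ah/e) B̄_n(bh/e)`. -/
noncomputable def barDedekindSum (m n a b e : ℕ) : ℝ :=
  ∑ h ∈ range e, bernoulliBar m (a * h / e) * bernoulliBar n (b * h / e)

theorem barDedekindSum_eq (m n a b e : ℕ) :
    barDedekindSum m n a b e = m.factorial * n.factorial * dedekindSum m n a b e := by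
  rw [barDedekindSum, dedekindSum, mul_sum]
  refine sum_congr rfl fun h _ => ?_
  rw [bernoulliBarDiv, bernoulliBarDiv]
  have h3 : (m.factorial : ℝ) ≠ 0 := by positivity
  have h4 : (n.factorial : ℝ) ≠ 0 := by positivity
  field_simp

/-- The reciprocity law for generalized Dedekind sums of Bernoulli functions. -/
theorem barDedekindSum_reciprocity {m n a b e : ℕ} [NeZero a] [NeZero b] [NeZero e] (hm : 0 < m)
    (hn : 0 < n) (hae : a.Coprime e) (hbe : b.Coprime e) :
    (e : ℝ) ^ (m + n - 1) * barDedekindSum m n a b e =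
      (-1) ^ (m + n) * (divisorTerm m n a b e + divisorTerm n m b a e) +
      (-1) ^ (n - 1) * m.factorial * n.factorial * (Nat.gcd a b : ℝ) ^ (m + n) *
        bernoulli (m + n) / (a ^ n * b ^ m * (m + n).factorial) * e ^ (m + n) -
      if m = 1 ∧ n = 1 then (e : ℝ) / 4 else 0 := by
  have ha : (a : ℝ) ≠ 0 := NeZero.ne _
  have hb : (b : ℝ) ≠ 0 := NeZero.ne _
  have he : (e : ℝ) ≠ 0 := NeZero.ne _
  have h := dedekindSum_reciprocity_aux hm hn hae hbe
  have h1 := sum_rightCoeff_eq_divisorTerm hm hn a b e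
  have h2 := sum_rightCoeff_eq_divisorTerm hn hm b a e
  rw [add_comm n m] at h2
  obtain ⟨N, hN⟩ : ∃ N, m + n = N + 1 := ⟨m + n - 1, by lia⟩
  have h3 := sum_leftCoeff_eq_sum_rightCoeff (N := N) hn fun p =>
    (e : ℝ) / e ^ p.1 * (-1) ^ p.1 * ((a / a ^ p.2) * dedekindSum p.2 p.1 a e b)
  have h4 : ∑ p ∈ antidiagonal (m + n), (e : ℝ) / e ^ p.1 * (-1) ^ p.1 *
      (leftCoeff p.1 n * (a / a ^ p.2) * dedekindSum p.2 p.1 a e b +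
        rightCoeff p.1 m * (b / b ^ p.2) * dedekindSum p.2 p.1 b e a) =
      (∑ p ∈ antidiagonal (m + n), leftCoeff p.1 n * ((e : ℝ) / e ^ p.1 * (-1) ^ p.1 *
        ((a / a ^ p.2) * dedekindSum p.2 p.1 a e b))) +
      ∑ p ∈ antidiagonal (m + n), (e : ℝ) / e ^ p.1 * (-1) ^ p.1 *
        (rightCoeff p.1 m * (b / b ^ p.2) * dedekindSum p.2 p.1 b e a) := by
    rw [← sum_add_distrib]
    exact sum_congr rfl fun p _ => by ring
  have h5 : ∑ p ∈ antidiagonal (m + n), rightCoeff p.1 n * ((e : ℝ) / e ^ p.1 * (-1) ^ p.1 *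
      ((a / a ^ p.2) * dedekindSum p.2 p.1 a e b)) =
      ∑ p ∈ antidiagonal (m + n), (e : ℝ) / e ^ p.1 * (-1) ^ p.1 *
        (rightCoeff p.1 n * (a / a ^ p.2) * dedekindSum p.2 p.1 a e b) :=
    sum_congr rfl fun p _ => by ring
  rw [← hN, h5] at h3
  rw [h4, h3] at h
  have h6 : bernoulliBarDiv (m + n) 0 = bernoulli (m + n) / (m + n).factorial := by
    rw [bernoulliBarDiv, bernoulliBar_of_ne_one (by lia), Int.fract_zero, bernoulliFun_eval_zero]
  rw [dedekindSum_zero_right, h6] at h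
  simp only [pow_zero, div_one, mul_one] at h
  rw [barDedekindSum_eq]
  set S1 := ∑ p ∈ antidiagonal (m + n), (e : ℝ) / e ^ p.1 * (-1) ^ p.1 *
        (rightCoeff p.1 n * (a / a ^ p.2) * dedekindSum p.2 p.1 a e b)
  set S2 := ∑ p ∈ antidiagonal (m + n), (e : ℝ) / e ^ p.1 * (-1) ^ p.1 *
        (rightCoeff p.1 m * (b / b ^ p.2) * dedekindSum p.2 p.1 b e a)
  have hpm (x : ℝ) (hx : x ≠ 0) (k : ℕ) (hk : 0 < k) : x ^ (k - 1) * (x / x ^ k) = 1 := by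
    rw [← mul_div_assoc, ← pow_succ, Nat.sub_add_cancel hk, div_self (pow_ne_zero _ hx)]
  have hpm2 (x : ℝ) (hx : x ≠ 0) (k l : ℕ) (hk : 0 < k) :
      x ^ (k - 1) * (x / x ^ (k + l)) = 1 / x ^ l := by
    rw [← mul_div_assoc, ← pow_succ, Nat.sub_add_cancel hk, pow_add]
    field_simp
  have hea : (e : ℝ) ^ (m + n - 1) * e = e ^ (m + n) := by
    rw [← pow_succ, Nat.sub_add_cancel (by lia)]
  have ham := hpm a ha m hm
  have hbn := hpm b hb n hn
  have ham2 := hpm2 a ha m n hm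
  have hbn2 := hpm2 b hb n m hn
  rw [add_comm n m] at hbn2
  set D := dedekindSum m n a b e
  set G : ℝ := (Nat.gcd a b : ℝ) ^ (m + n)
  set B : ℝ := (bernoulli (m + n) : ℝ) / (m + n).factorial with hB
  set ε : ℝ := if m = 1 ∧ n = 1 then 1 / 4 else 0 with hε
  have hfin : (m.factorial : ℝ) * n.factorial * (a ^ (m - 1) * b ^ (n - 1) * e ^ (m + n - 1)) * ε =
      if m = 1 ∧ n = 1 then (e : ℝ) / 4 else 0 := by
    rw [hε]
    split_ifs with h
    · rw [h.1, h.2]; simp; ring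
    · simp
  rw [← hfin, mul_add, ← h1, ← h2]
  have hC : (-1) ^ (n - 1) * (m.factorial : ℝ) * n.factorial * G *
      bernoulli (m + n) / (a ^ n * b ^ m * (m + n).factorial) * e ^ (m + n) =
      (m.factorial : ℝ) * n.factorial * ((-1) ^ (n - 1) * (G * B)) *
        (1 / a ^ n) * (1 / b ^ m) * e ^ (m + n) := by
    rw [hB]; field_simp
  rw [hC, ← ham2, ← hbn2, ← hea]
  -- The auxiliary identity is multiplied by `m! n! a^(m-1) b^(n-1) e^(m+n-1)`, which clears the
  -- powers left by Raabe's formula.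
  linear_combination ((m.factorial : ℝ) * n.factorial * e ^ (m + n - 1)) *
    ((a ^ (m - 1) * b ^ (n - 1)) * h - D * ham * (b ^ (n - 1) * (b / b ^ n)) - D * hbn)

end DirichletMean

/-! ### Fourier expansion of the Bernoulli functions, including order one. -/

namespace DirichletMean

open Finset Complex HurwitzZeta Filter Topology Asymptotics MeasureTheory

section expZetaOne

variable {z : ℂ}

theorem one_sub_mul_exp_neg_re_pos (hz : ‖z‖ = 1) {t : ℝ} (ht : 0 < t) :
    0 < (1 - z * Real.exp (-t)).re := by
  have h1 : (z * Real.exp (-t)).re ≤ Real.exp (-t) := by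
    refine (re_le_norm _).trans ?_
    rw [norm_mul, hz, one_mul, norm_real, Real.norm_of_nonneg (Real.exp_pos _).le]
  have h2 : Real.exp (-t) < 1 := Real.exp_lt_one_iff.2 (by linarith)
  rw [sub_re, one_re]
  linarith

theorem one_sub_re_pos (hz : ‖z‖ = 1) (hz1 : z ≠ 1) : 0 < (1 - z).re := by
  rw [sub_re, one_re, sub_pos]
  refine lt_of_le_of_ne ((re_le_norm z).trans hz.le) fun h => hz1 ?_
  have h2 := Complex.sq_norm z
  rw [hz, normSq_apply, h] at h2
  have him : z.im = 0 := by nlinarith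
  exact Complex.ext (by simpa using h) (by simpa using him)

/-- The generating function `∑_{n ≥ 1} z^n e^{-nt}`. -/
noncomputable def geomExp (z : ℂ) (t : ℝ) : ℂ :=
  z * Real.exp (-t) / (1 - z * Real.exp (-t))

theorem hasSum_geomExp (hz : ‖z‖ = 1) {t : ℝ} (ht : 0 < t) :
    HasSum (fun n : ℕ => (if n = 0 then 0 else z ^ n) * (Real.exp (-(n : ℝ) * t) : ℂ))
      (geomExp z t) := by
  have hlt : ‖z * Real.exp (-t)‖ < 1 := by
    rw [norm_mul, hz, one_mul, norm_real, Real.norm_of_nonneg (Real.exp_pos _).le]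
    exact Real.exp_lt_one_iff.2 (by linarith)
  have h := (hasSum_geometric_of_norm_lt_one hlt).mul_left (z * Real.exp (-t))
  rw [← hasSum_nat_add_iff' 1]
  convert! h using 1
  · ext n
    rw [if_neg (Nat.succ_ne_zero n), ← pow_succ', mul_pow, ← ofReal_pow, ← Real.exp_nat_mul]
    congr 3
    push_cast; ring
  · simp [geomExp, div_eq_mul_inv]

theorem continuousOn_geomExp (hz : ‖z‖ = 1) : ContinuousOn (geomExp z) (Set.Ioi 0) := by
  unfold geomExp
  refine ContinuousOn.div (by fun_prop) (by fun_prop) fun t ht h => ?_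
  have := one_sub_mul_exp_neg_re_pos hz ht
  rw [h] at this
  simp at this

theorem tendsto_one_sub_mul_exp_neg_atTop (z : ℂ) :
    Tendsto (fun t : ℝ => 1 - z * Real.exp (-t)) atTop (𝓝 1) := by
  have h : Tendsto (fun t : ℝ => ((Real.exp (-t) : ℝ) : ℂ)) atTop (𝓝 ((0 : ℝ) : ℂ)) :=
    (continuous_ofReal.tendsto _).comp
      (Real.tendsto_exp_atBot.comp tendsto_neg_atTop_atBot)
  simpa using (h.const_mul z).const_sub 1

theorem geomExp_isBigO_atTop (hz : ‖z‖ = 1) :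
    geomExp z =O[atTop] fun t => Real.exp (-1 * t) := by
  have h1 : (fun t : ℝ => z * (Real.exp (-t) : ℂ)) =O[atTop] fun t => Real.exp (-1 * t) := by
    refine IsBigO.of_bound 1 (Eventually.of_forall fun t => ?_)
    rw [norm_mul, hz, norm_real]
    simp
  have h2 : (fun t : ℝ => (1 - z * (Real.exp (-t) : ℂ))⁻¹) =O[atTop] fun _ => (1 : ℝ) :=
    ((tendsto_one_sub_mul_exp_neg_atTop z).inv₀ one_ne_zero).isBigO_one ℝ
  have h := h1.mul h2
  simp only [mul_one] at h
  exact h.congr_left fun t => (div_eq_mul_inv _ _).symm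

theorem one_sub_ne_zero (hz1 : z ≠ 1) : 1 - z ≠ 0 := sub_ne_zero.2 hz1.symm

theorem geomExp_isBigO_zero (hz1 : z ≠ 1) :
    geomExp z =O[𝓝[>] 0] fun t : ℝ => t ^ (-(0 : ℝ)) := by
  have hc : ContinuousAt (geomExp z) 0 := by
    unfold geomExp
    refine ContinuousAt.div (by fun_prop) (by fun_prop) ?_
    simpa using one_sub_ne_zero hz1
  simpa using (hc.tendsto.mono_left nhdsWithin_le_nhds).isBigO_one ℝ

theorem locallyIntegrableOn_geomExp (hz : ‖z‖ = 1) :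
    LocallyIntegrableOn (geomExp z) (Set.Ioi 0) :=
  (continuousOn_geomExp hz).locallyIntegrableOn measurableSet_Ioi

/-- The function `t ↦ log(1 - z e^{-t})` is a primitive: its argument stays in the right half-plane,
away from the branch cut. -/
theorem integral_geomExp (hz : ‖z‖ = 1) (hz1 : z ≠ 1) :
    ∫ t in Set.Ioi (0 : ℝ), geomExp z t = -Complex.log (1 - z) := by
  have hint : IntegrableOn (geomExp z) (Set.Ioi 0) := by
    have h := mellinConvergent_of_isBigO_rpow_exp one_pos (s := 1) (locallyIntegrableOn_geomExp hz)
      (geomExp_isBigO_atTop hz) (geomExp_isBigO_zero hz1) (by simp)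
    simpa [MellinConvergent] using h
  have h := integral_Ioi_of_hasDerivAt_of_tendsto
    (f := fun t : ℝ => Complex.log (1 - z * (Real.exp (-t) : ℂ))) (f' := geomExp z) (a := 0)
    (m := Complex.log 1) ?_ ?_ hint ?_
  · rw [h]; simp
  · refine ContinuousAt.continuousWithinAt (ContinuousAt.clog (by fun_prop) (Or.inl ?_))
    simpa using one_sub_re_pos hz hz1
  · intro t ht
    have h1 : HasDerivAt (fun t : ℝ => 1 - z * (Real.exp (-t) : ℂ)) (z * (Real.exp (-t) : ℂ)) t := by
      have h2 : HasDerivAt (fun t : ℝ => (Real.exp (-t) : ℂ)) ((-Real.exp (-t) : ℝ) : ℂ) t := by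
        have := (Real.hasDerivAt_exp (-t)).comp t (hasDerivAt_neg t)
        exact (this.ofReal_comp).congr_deriv (by simp)
      exact ((h2.const_mul z).const_sub 1).congr_deriv (by push_cast; ring)
    exact h1.clog_real (Or.inl (one_sub_mul_exp_neg_re_pos hz ht))
  · exact (continuousAt_clog (by simp)).tendsto.comp (tendsto_one_sub_mul_exp_neg_atTop z)

end expZetaOne

/-- For `Re s > 1`, `Γ(s) expZeta(x, s)` is the Mellin transform of `∑ z^n e^{-nt}`. Because `z ≠
1`, that function is bounded near `t = 0`, so both sides are continuous at `s = 1` and the identity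
extends there. -/
theorem expZeta_one {x : ℝ} (h0 : 0 < x) (h1 : x < 1) :
    expZeta (x : UnitAddCircle) 1 = -Complex.log (1 - cexp (2 * Real.pi * I * x)) := by
  set z := cexp (2 * Real.pi * I * x) with hzdef
  have hz : ‖z‖ = 1 := by
    rw [hzdef, show (2 * Real.pi * I * x : ℂ) = ((2 * Real.pi * x : ℝ) : ℂ) * I by push_cast; ring]
    exact norm_exp_ofReal_mul_I _
  have hz1 : z ≠ 1 := by
    intro h
    obtain ⟨n, hn⟩ := Complex.exp_eq_one_iff.1 h
    have hx : (x : ℂ) = n := by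
      have : (2 * Real.pi * I : ℂ) ≠ 0 := by simp [Real.pi_ne_zero]
      exact mul_left_cancel₀ this (by rw [hn]; ring)
    have hx' : x = n := by exact_mod_cast hx
    rw [hx'] at h0 h1
    have h0' : 0 < n := by exact_mod_cast h0
    have h1' : n < 1 := by exact_mod_cast h1
    lia
  have hx0 : (x : UnitAddCircle) ≠ 0 := by
    intro h
    obtain ⟨n, hn⟩ := (AddCircle.coe_eq_zero_iff 1).1 h
    rw [zsmul_one] at hn
    rw [← hn] at h0 h1
    have h0' : 0 < n := by exact_mod_cast h0
    have h1' : n < 1 := by exact_mod_cast h1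
    lia
  have hM {s : ℂ} (hs : 1 < s.re) : Gamma s * expZeta x s = mellin (geomExp z) s := by
    have hsum := hasSum_mellin (a := fun n : ℕ => if n = 0 then 0 else z ^ n)
      (p := fun n : ℕ => (n : ℝ)) (F := geomExp z) (s := s) (fun n => ?_) (by linarith)
      (fun t ht => ?_) ?_
    · refine HasSum.unique ?_ hsum
      convert! (hasSum_expZeta_of_one_lt_re x hs).mul_left (Gamma s) using 1
      ext n
      rcases eq_or_ne n 0 with rfl | hn
      · have : s ≠ 0 := by rintro rfl; simp at hs; linarith
        simp [this]
      · rw [if_neg hn, hzdef, ← Complex.exp_nat_mul, mul_div_assoc, mul_comm (n : ℂ)]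
        simp
    · rcases eq_or_ne n 0 with rfl | hn
      · simp
      · exact Or.inr (by positivity)
    · exact hasSum_geomExp hz ht
    · refine Summable.of_nonneg_of_le (fun n => by positivity) (fun n => ?_)
        (Real.summable_one_div_nat_rpow.2 hs)
      gcongr
      split_ifs <;> simp [hz]
  have hc1 : Tendsto (fun u : ℝ => Gamma u * expZeta x u) (𝓝[>] 1) (𝓝 (Gamma 1 * expZeta x 1)) := by
    have hd : ContinuousAt (fun s : ℂ => Gamma s * expZeta x s) ((1 : ℝ) : ℂ) := by
      refine ((differentiableAt_Gamma _ fun m => ?_).mul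
        (differentiableAt_expZeta _ _ (Or.inr hx0))).continuousAt
      norm_cast
      lia
    have := (hd.comp (f := fun u : ℝ => (u : ℂ)) continuous_ofReal.continuousAt).tendsto
    exact_mod_cast this.mono_left nhdsWithin_le_nhds
  have hc2 : Tendsto (fun u : ℝ => mellin (geomExp z) u) (𝓝[>] 1) (𝓝 (mellin (geomExp z) 1)) := by
    have hd : ContinuousAt (mellin (geomExp z)) ((1 : ℝ) : ℂ) :=
      (mellin_differentiableAt_of_isBigO_rpow_exp one_pos (locallyIntegrableOn_geomExp hz)
        (geomExp_isBigO_atTop hz) (geomExp_isBigO_zero hz1) (by simp)).continuousAt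
    have := (hd.comp (f := fun u : ℝ => (u : ℂ)) continuous_ofReal.continuousAt).tendsto
    exact_mod_cast this.mono_left nhdsWithin_le_nhds
  have heq : (fun u : ℝ => mellin (geomExp z) u) =ᶠ[𝓝[>] 1] fun u : ℝ => Gamma u * expZeta x u := by
    filter_upwards [self_mem_nhdsWithin] with u hu
    exact (hM (by simpa using hu)).symm
  have h := tendsto_nhds_unique hc1 (hc2.congr' heq)
  rw [Complex.Gamma_one, one_mul] at h
  rw [h, ← integral_geomExp hz hz1, mellin]
  simp

/-- Since `1 - e(x) = 2 sin(πx) exp(i(πx - π/2))`, the sine series is minus the argument `πx - π/2`.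
-/
theorem sinZeta_one {x : ℝ} (h0 : 0 < x) (h1 : x < 1) :
    sinZeta (x : UnitAddCircle) 1 = Real.pi * (1 / 2 - x) := by
  have hneg : -(x : UnitAddCircle) = ((1 - x : ℝ) : UnitAddCircle) := by
    rw [AddCircle.coe_sub, AddCircle.coe_period, zero_sub]
  have hsin : 0 < Real.sin (Real.pi * x) :=
    Real.sin_pos_of_pos_of_lt_pi (by positivity) (by nlinarith [Real.pi_pos])
  set θ : ℝ := Real.pi * x - Real.pi / 2 with hθ
  have hz : 1 - cexp (2 * Real.pi * I * x) = ((2 * Real.sin (Real.pi * x) : ℝ) : ℂ) *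
      (Complex.cos θ + Complex.sin θ * I) := by
    rw [show (2 * Real.pi * I * x : ℂ) = (2 * (Real.pi * x : ℝ) : ℂ) * I by push_cast; ring,
      Complex.exp_mul_I, Complex.cos_two_mul, Complex.sin_two_mul, ← ofReal_cos, ← ofReal_sin,
      ← ofReal_cos θ, ← ofReal_sin θ, hθ, Real.cos_sub_pi_div_two, Real.sin_sub_pi_div_two]
    have h := Real.sin_sq_add_cos_sq (Real.pi * x)
    have h' : (Real.sin (Real.pi * x) : ℂ) ^ 2 + (Real.cos (Real.pi * x) : ℂ) ^ 2 = 1 := by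
      exact_mod_cast h
    push_cast at h' ⊢
    linear_combination -2 * h'
  have hzc : 1 - cexp (2 * Real.pi * I * (1 - x : ℝ)) = conj (1 - cexp (2 * Real.pi * I * x)) := by
    rw [map_sub, map_one, ← Complex.exp_conj]
    simp only [map_mul, conj_I, conj_ofReal, map_ofNat]
    rw [show (2 * Real.pi * I * (1 - x : ℝ) : ℂ) = 2 * Real.pi * -I * x + 2 * Real.pi * I by
      push_cast; ring, Complex.exp_add, Complex.exp_two_pi_mul_I, mul_one]
  have harg : (1 - cexp (2 * Real.pi * I * x)).arg = θ := by
    rw [hz]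
    refine Complex.arg_mul_cos_add_sin_mul_I (by positivity) ⟨?_, ?_⟩ <;>
      rw [hθ] <;> nlinarith [Real.pi_pos]
  have hne : (1 - cexp (2 * Real.pi * I * x)).arg ≠ Real.pi := by
    rw [harg, hθ]; nlinarith [Real.pi_pos]
  rw [sinZeta_eq, hneg, expZeta_one h0 h1, expZeta_one (by linarith) (by linarith), hzc,
    Complex.log_conj _ hne]
  have him : (Complex.log (1 - cexp (2 * Real.pi * I * x))).im = θ := by
    rw [Complex.log_im, harg]
  have hsub := Complex.sub_conj (Complex.log (1 - cexp (2 * Real.pi * I * x)))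
  rw [him] at hsub
  rw [show -Complex.log (1 - cexp (2 * Real.pi * I * x)) -
    -conj (Complex.log (1 - cexp (2 * Real.pi * I * x))) =
    -(Complex.log (1 - cexp (2 * Real.pi * I * x)) -
      conj (Complex.log (1 - cexp (2 * Real.pi * I * x)))) by ring, hsub, hθ]
  have hI : (2 * I : ℂ) ≠ 0 := by simp
  push_cast
  field_simp
  ring

theorem eval_bernoulli_ofReal (k : ℕ) (x : ℝ) :
    ((Polynomial.bernoulli k).map (algebraMap ℚ ℂ)).eval (x : ℂ) = (bernoulliFun k x : ℂ) := by
  rw [bernoulliFun, show algebraMap ℚ ℂ = ofRealHom.comp (algebraMap ℚ ℝ) from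
    Subsingleton.elim _ _, ← Polynomial.map_map, ← ofRealHom_eq_coe, ← ofRealHom_eq_coe,
    Polynomial.eval_map_apply]

/-- The Fourier expansion of the Bernoulli functions, in terms of `expZeta`. -/
theorem expZeta_add_expZeta_neg {k : ℕ} (hk : 0 < k) (x : ℝ) :
    expZeta (x : UnitAddCircle) k + (-1) ^ k * expZeta (-(x : UnitAddCircle)) k =
      -(2 * Real.pi * I) ^ k / k.factorial * (bernoulliBar k x : ℂ) := by
  have hx : (x : UnitAddCircle) = ((Int.fract x : ℝ) : UnitAddCircle) := by
    rw [Int.fract, AddCircle.coe_sub, eq_comm, sub_eq_self]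
    exact (AddCircle.coe_eq_zero_iff 1).2 ⟨⌊x⌋, by simp⟩
  rw [hx, ← bernoulliBar_fract]
  have h0 := Int.fract_nonneg x
  have h1 := Int.fract_lt_one x
  set y := Int.fract x
  have hI : (I : ℂ) ^ 2 = -1 := I_sq
  rcases Nat.even_or_odd' k with ⟨j, rfl | rfl⟩
  · have hj : j ≠ 0 := by lia
    have hc := cosZeta_two_mul_nat hj (x := y) ⟨h0, h1.le⟩
    rw [cosZeta_eq, eval_bernoulli_ofReal] at hc
    rw [bernoulliBar_of_ne_one (by lia), Int.fract_eq_self.2 ⟨h0, h1⟩, pow_mul (-1 : ℂ)]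
    push_cast at hc ⊢
    rw [mul_pow _ I, pow_mul I, hI, neg_one_sq, one_pow, one_mul]
    linear_combination 2 * hc
  · have hs : expZeta (y : UnitAddCircle) ((2 * j + 1 : ℕ) : ℂ) +
        (-1) ^ (2 * j + 1) * expZeta (-(y : UnitAddCircle)) ((2 * j + 1 : ℕ) : ℂ) =
        2 * I * sinZeta (y : UnitAddCircle) ((2 * j + 1 : ℕ) : ℂ) := by
      rw [sinZeta_eq, mul_div_cancel₀ _ (by simp : (2 * I : ℂ) ≠ 0), pow_succ, pow_mul]
      simp [sub_eq_add_neg]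
    rw [hs]
    rcases eq_or_ne j 0 with rfl | hj
    -- At integers the sine series is zero by oddness, which is why `B̄_1` must be `0` there.
    · rcases eq_or_lt_of_le h0 with h | h
      · rw [← h]
        have : bernoulliBar (2 * 0 + 1) 0 = 0 := by norm_num [bernoulliBar_eq]
        have hz := sinZeta_neg (0 : UnitAddCircle) ((2 * 0 + 1 : ℕ) : ℂ)
        rw [neg_zero, self_eq_neg] at hz
        rw [this, AddCircle.coe_zero, hz]
        simp
      · rw [bernoulliBar_of_mem_Ico h0 h1]
        have := sinZeta_one h h1
        simp only [mul_zero, zero_add, Nat.cast_one, this, h.ne', and_false, if_false, add_zero]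
        rw [bernoulliFun_one]
        push_cast
        simp
        ring
    · have hc := sinZeta_two_mul_nat_add_one hj (x := y) ⟨h0, h1.le⟩
      rw [eval_bernoulli_ofReal] at hc
      rw [bernoulliBar_of_ne_one (by lia), Int.fract_eq_self.2 ⟨h0, h1⟩]
      push_cast at hc ⊢
      rw [hc, mul_pow _ I, pow_succ I, pow_mul I, hI]
      ring

end DirichletMean

/-! ### Finite formulas for `L(m, χ)` and orthogonality of characters. -/

namespace DirichletMean

open Finset Complex HurwitzZeta
open scoped ZMod

/-- The Bernoulli function `x ↦ B̄_k(x / q)` on `ZMod q`. -/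
noncomputable def bernoulliZMod (q k : ℕ) (x : ZMod q) : ℂ := bernoulliBar k (x.val / q)

theorem bernoulliZMod_intCast (q k : ℕ) [NeZero q] (j : ℤ) :
    bernoulliZMod q k (j : ZMod q) = bernoulliBar k (j / q) := by
  have hp := bernoulliBar_intCast_div_periodic k q 0 1
  simp only [zero_add, Int.cast_one, one_mul] at hp
  have := periodic_val_intCast hp j
  simp only [Int.cast_natCast] at this
  rw [bernoulliZMod, this]

theorem bernoulliZMod_neg (q k : ℕ) [NeZero q] (x : ZMod q) :
    bernoulliZMod q k (-x) = (-1) ^ k * bernoulliZMod q k x := by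
  obtain ⟨j, rfl⟩ := ZMod.intCast_surjective x
  rw [← Int.cast_neg, bernoulliZMod_intCast, bernoulliZMod_intCast, Int.cast_neg, neg_div,
    bernoulliBar_neg]
  push_cast; rfl

/-- The coefficients of the finite expansion of `L(m, χ)` in the values of `χ`. -/
noncomputable def lCoeff (q m : ℕ) [NeZero q] (y : ZMod q) : ℂ :=
  -(2 * Real.pi * I) ^ m / (2 * m.factorial * q) *
    ∑ x : ZMod q, ZMod.stdAddChar (-(x * y)) * bernoulliZMod q m x

theorem lCoeff_neg (q m : ℕ) [NeZero q] (y : ZMod q) :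
    lCoeff q m (-y) = (-1) ^ m * lCoeff q m y := by
  rw [lCoeff, lCoeff, mul_left_comm, mul_sum univ _ ((-1 : ℂ) ^ m)]
  congr 1
  refine Fintype.sum_equiv (Equiv.neg _) _ _ fun x => ?_
  rw [Equiv.neg_apply, bernoulliZMod_neg, ← mul_assoc, mul_comm ((-1 : ℂ) ^ m), mul_assoc,
    ← mul_assoc ((-1 : ℂ) ^ m), ← mul_pow]
  simp

/-- Writing `χ` as the discrete Fourier transform of `Φ` makes `L(m, χ)` a combination of `expZeta`
values. `Φ` has the parity of `m`, so averaging over `x` and `-x` leaves only the combination equal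
to a Bernoulli function. -/
theorem LFunction_eq_sum_lCoeff {q m : ℕ} [NeZero q] (hm : 0 < m) (χ : DirichletCharacter ℂ q)
    (hχ : χ (-1) = (-1) ^ m) :
    DirichletCharacter.LFunction χ m = ∑ y : ZMod q, χ y * lCoeff q m y := by
  set Φ : ZMod q → ℂ := 𝓕⁻ (χ : ZMod q → ℂ) with hΦ
  have hχΦ : 𝓕 Φ = (χ : ZMod q → ℂ) := ZMod.dft.apply_symm_apply _
  have hq : (q : ℂ) ≠ 0 := NeZero.ne _
  have happly (x : ZMod q) :
      Φ x = (q : ℂ)⁻¹ * ∑ y : ZMod q, ZMod.stdAddChar (y * x) * χ y := by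
    rw [hΦ, ZMod.invDFT_apply]
    simp [smul_eq_mul]
  have hsq : ((-1 : ℂ) ^ m) * (-1) ^ m = 1 := by rw [← mul_pow]; simp
  have hneg (x : ZMod q) : Φ (-x) = (-1) ^ m * Φ x := by
    rw [happly, happly, mul_left_comm, mul_sum univ _ ((-1 : ℂ) ^ m)]
    congr 1
    refine Fintype.sum_equiv (Equiv.neg _) _ _ fun y => ?_
    have hy : χ (-y) = (-1) ^ m * χ y := by rw [← neg_one_mul y, map_mul, hχ]
    rw [Equiv.neg_apply, hy, neg_mul_comm]
    linear_combination (-(ZMod.stdAddChar (y * -x) * χ y)) * hsq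
  -- A term at `x = 0` would bring in the pole of zeta at `s = 1`; for `m = 1` the function `Φ` is
  -- odd and the term vanishes.
  have hs : Φ 0 = 0 ∨ (m : ℂ) ≠ 1 := by
    by_cases h1 : m = 1
    · left
      have := hneg 0
      rw [neg_zero, h1, pow_one, neg_one_mul, self_eq_neg] at this
      exact this
    · exact Or.inr (by exact_mod_cast h1)
  have hL : DirichletCharacter.LFunction χ m =
      ∑ x : ZMod q, Φ x * expZeta (ZMod.toAddCircle (-x)) m := by
    rw [← ZMod.LFunction_dft Φ hs, hχΦ, DirichletCharacter.LFunction]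
  have hL' : DirichletCharacter.LFunction χ m =
      ∑ x : ZMod q, (-1) ^ m * Φ x * expZeta (ZMod.toAddCircle x) m := by
    rw [hL]
    refine Fintype.sum_equiv (Equiv.neg _) _ _ fun x => ?_
    rw [Equiv.neg_apply, hneg, ← mul_assoc, hsq, one_mul]
  have h2 : 2 * DirichletCharacter.LFunction χ m =
      ∑ x : ZMod q, (-1) ^ m * Φ x * (-(2 * Real.pi * I) ^ m / m.factorial * bernoulliZMod q m x) := by
    rw [two_mul]
    nth_rewrite 1 [hL']
    rw [hL, ← sum_add_distrib]
    refine sum_congr rfl fun x _ => ?_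
    have hx : ZMod.toAddCircle x = ((x.val / q : ℝ) : UnitAddCircle) := ZMod.toAddCircle_apply x
    rw [bernoulliZMod, ← expZeta_add_expZeta_neg hm, map_neg, hx]
    linear_combination (-(Φ x * expZeta (-((x.val / q : ℝ) : UnitAddCircle)) m)) * hsq
  have h3 : ∑ x : ZMod q, (-1) ^ m * Φ x * bernoulliZMod q m x =
      (q : ℂ)⁻¹ * ∑ y : ZMod q, χ y * ∑ x : ZMod q, ZMod.stdAddChar (-(x * y)) * bernoulliZMod q m x := by
    have hx (x : ZMod q) : (-1) ^ m * Φ x =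
        (q : ℂ)⁻¹ * ∑ y : ZMod q, ZMod.stdAddChar (-(x * y)) * χ y := by
      rw [← hneg, happly]
      simp only [mul_neg, mul_comm]
    simp only [hx, mul_sum, sum_mul]
    rw [sum_comm]
    exact sum_congr rfl fun y _ => sum_congr rfl fun x _ => by ring
  have h4 : 2 * DirichletCharacter.LFunction χ m = -(2 * Real.pi * I) ^ m / m.factorial *
      ∑ x : ZMod q, (-1) ^ m * Φ x * bernoulliZMod q m x := by
    rw [h2, mul_sum]
    exact sum_congr rfl fun x _ => by ring
  rw [h3] at h4
  have h5 : ∑ y : ZMod q, χ y * lCoeff q m y =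
      -(2 * Real.pi * I) ^ m / (2 * m.factorial * q) *
      ∑ y : ZMod q, χ y * ∑ x : ZMod q, ZMod.stdAddChar (-(x * y)) * bernoulliZMod q m x := by
    rw [mul_sum]
    exact sum_congr rfl fun y _ => by rw [lCoeff]; ring
  rw [h5]
  have hf : (m.factorial : ℂ) ≠ 0 := by exact_mod_cast m.factorial_ne_zero
  refine mul_left_cancel₀ (two_ne_zero (α := ℂ)) (h4.trans ?_)
  field_simp

theorem sum_char_mul_lCoeff_eq_zero {q m : ℕ} [NeZero q] (χ : DirichletCharacter ℂ q)
    (hχ : χ (-1) ≠ (-1) ^ m) : ∑ y : ZMod q, χ y * lCoeff q m y = 0 := by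
  have h : ∑ y : ZMod q, χ y * lCoeff q m y =
      χ (-1) * (-1) ^ m * ∑ y : ZMod q, χ y * lCoeff q m y := by
    rw [mul_sum]
    refine Fintype.sum_equiv (Equiv.neg _) _ _ fun y => ?_
    rw [Equiv.neg_apply, lCoeff_neg, ← neg_one_mul y, map_mul]
    have h1 : χ (-1) * χ (-1) = 1 := by rw [← map_mul]; simp
    have hsq : ((-1 : ℂ) ^ m) * (-1) ^ m = 1 := by rw [← mul_pow]; simp
    linear_combination (-(χ y * lCoeff q m y)) * hsq -
      (χ y * lCoeff q m y * ((-1) ^ m * (-1) ^ m)) * h1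
  have h1 : χ (-1) * (-1) ^ m ≠ 1 := by
    intro h'
    apply hχ
    have hsq : ((-1 : ℂ) ^ m) * (-1) ^ m = 1 := by rw [← mul_pow]; simp
    linear_combination (-1) ^ m * h' - χ (-1) * hsq
  by_contra h0
  exact h1 (mul_right_cancel₀ h0 (by rw [one_mul]; exact h.symm))

theorem inv_apply_neg_one {q : ℕ} (χ : DirichletCharacter ℂ q) : χ⁻¹ (-1) = χ (-1) := by
  rw [MulChar.inv_apply_eq_inv']
  have h1 : χ (-1) * χ (-1) = 1 := by rw [← map_mul]; simp
  exact inv_eq_of_mul_eq_one_left h1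

-- The substitutions `y = bw` and `z = aw'` absorb the factor `χ(a) χ̄(b)`, leaving `χ(w) χ̄(w')`,
-- whose sum over `χ` forces `w = w'` to be a unit.
open Classical in
theorem V_eq_sum_units {q m n a b : ℕ} [NeZero q] (hm : 0 < m) (hn : 0 < n)
    (haq : a.Coprime q) (hbq : b.Coprime q) (hmn : ((-1) ^ m : ℂ) = (-1) ^ n) :
    V q m n a b = q.totient * ∑ w : ZMod q with IsUnit w, lCoeff q m (b * w) * lCoeff q n (a * w) := by
  have h1 : V q m n a b = ∑ χ : DirichletCharacter ℂ q,
      χ (a : ZMod q) * χ⁻¹ (b : ZMod q) * (∑ y : ZMod q, χ y * lCoeff q m y) *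
        ∑ z : ZMod q, χ⁻¹ z * lCoeff q n z := by
    rw [V, sum_filter]
    refine sum_congr rfl fun χ _ => ?_
    simp only [hmn, and_true]
    split_ifs with hχ
    · rw [LFunction_eq_sum_lCoeff hm χ (hχ.trans hmn.symm), MulChar.star_eq_inv,
        LFunction_eq_sum_lCoeff hn χ⁻¹ ((inv_apply_neg_one χ).trans hχ), ← MulChar.star_apply']
      simp
    · rw [sum_char_mul_lCoeff_eq_zero χ (by rwa [hmn])]
      simp
  set ua := ZMod.unitOfCoprime a haq with hua
  set ub := ZMod.unitOfCoprime b hbq with hub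
  have hua' : (ua : ZMod q) = a := ZMod.coe_unitOfCoprime a haq
  have hub' : (ub : ZMod q) = b := ZMod.coe_unitOfCoprime b hbq
  have hsum (χ : DirichletCharacter ℂ q) (u : (ZMod q)ˣ) (k : ℕ) :
      ∑ y : ZMod q, χ y * lCoeff q k y = χ u * ∑ w : ZMod q, χ w * lCoeff q k (u * w) := by
    rw [mul_sum]
    refine (Fintype.sum_equiv (Units.mulLeft u) _ _ fun w => ?_).symm
    rw [Units.mulLeft_apply, map_mul]
    ring
  have hinv (χ : DirichletCharacter ℂ q) (u : (ZMod q)ˣ) : χ u * χ⁻¹ u = 1 := by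
    rw [← MulChar.mul_apply, mul_inv_cancel, MulChar.one_apply_coe]
  have h2 : V q m n a b = ∑ χ : DirichletCharacter ℂ q, ∑ w : ZMod q, ∑ w' : ZMod q,
      χ w * χ⁻¹ w' * (lCoeff q m (b * w) * lCoeff q n (a * w')) := by
    rw [h1]
    refine sum_congr rfl fun χ _ => ?_
    rw [hsum χ ub, hsum χ⁻¹ ua, ← hua', ← hub']
    have h : ∑ w : ZMod q, ∑ w' : ZMod q,
        χ w * χ⁻¹ w' * (lCoeff q m (ub * w) * lCoeff q n (ua * w')) =
        (∑ w : ZMod q, χ w * lCoeff q m (ub * w)) * ∑ w' : ZMod q, χ⁻¹ w' * lCoeff q n (ua * w') := by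
      rw [sum_mul_sum]
      exact sum_congr rfl fun _ _ => sum_congr rfl fun _ _ => by ring
    rw [h]
    set S := ∑ w : ZMod q, χ w * lCoeff q m (ub * w)
    set T := ∑ w' : ZMod q, χ⁻¹ w' * lCoeff q n (ua * w')
    linear_combination (χ ub * χ⁻¹ ub * S * T) * hinv χ ua + S * T * hinv χ ub
  have h3 (w w' : ZMod q) : ∑ χ : DirichletCharacter ℂ q, χ w * χ⁻¹ w' =
      if IsUnit w' ∧ w' = w then (q.totient : ℂ) else 0 := by
    by_cases hw : IsUnit w'
    · have := DirichletCharacter.sum_char_inv_mul_char_eq ℂ hw w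
      simp only [hw, true_and]
      rw [← this]
      refine sum_congr rfl fun χ _ => ?_
      obtain ⟨u, rfl⟩ := hw
      rw [MulChar.inv_apply, Ring.inverse_unit, ← ZMod.inv_coe_unit, mul_comm]
    · simp [hw, MulChar.map_nonunit]
  rw [h2, sum_comm, sum_filter, mul_sum]
  refine sum_congr rfl fun w _ => ?_
  rw [sum_comm]
  simp only [← sum_mul, h3]
  rw [sum_eq_single w]
  · split_ifs <;> simp_all
  · intro w' _ hw
    simp [hw]
  · simp

end DirichletMean

/-! ### Ramanujan sums and reduction to Dedekind sums. -/

namespace DirichletMean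

open Finset Complex

theorem sum_range_mul_eq {M : Type*} [AddCommMonoid M] (c d : ℕ) (F : ℕ → M) :
    ∑ i ∈ range (c * d), F i = ∑ x ∈ range d, ∑ t ∈ range c, F (x + d * t) := by
  induction c with
  | zero => simp
  | succ c ih =>
    simp only [sum_range_succ, sum_add_distrib]
    rw [Nat.succ_mul, sum_range_add, ih, mul_comm c d]
    simp only [add_comm]

theorem sum_stdAddChar_range (d : ℕ) [NeZero d] (k : ℤ) :
    ∑ t ∈ range d, ZMod.stdAddChar ((t : ZMod d) * (k : ZMod d)) = if (d : ℤ) ∣ k then (d : ℂ) else 0 := by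
  have h := AddChar.sum_mulShift (k : ZMod d) (ZMod.isPrimitive_stdAddChar d)
  have h2 := sum_range_eq_sum_zmod d fun t : ℤ => ZMod.stdAddChar ((t : ZMod d) * (k : ZMod d))
  simp only [Int.cast_natCast, ZMod.natCast_zmod_val] at h2
  rw [h2, h]
  simp only [ZMod.intCast_zmod_eq_zero_iff_dvd, ZMod.card]
  split_ifs <;> simp

open Classical in
/-- The evaluation of Ramanujan sums. -/
theorem sum_units_stdAddChar (q : ℕ) [NeZero q] (k : ℤ) :
    ∑ w : ZMod q with IsUnit w, ZMod.stdAddChar (w * (k : ZMod q)) =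
      ∑ d ∈ q.divisors, (ArithmeticFunction.moebius (q / d) : ℂ) *
        if (d : ℤ) ∣ k then (d : ℂ) else 0 := by
  have hq : q ≠ 0 := NeZero.ne q
  have h1 : ∑ w : ZMod q with IsUnit w, ZMod.stdAddChar (w * (k : ZMod q)) =
      ∑ w ∈ range q, if w.Coprime q then ZMod.stdAddChar ((w : ZMod q) * (k : ZMod q)) else 0 := by
    have := sum_range_eq_sum_zmod q fun w : ℤ =>
      if IsUnit (w : ZMod q) then ZMod.stdAddChar ((w : ZMod q) * (k : ZMod q)) else 0
    simp only [Int.cast_natCast, ZMod.natCast_zmod_val] at this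
    rw [sum_filter, ← this]
    simp only [ZMod.isUnit_iff_coprime]
  have h2 (w : ℕ) : (if w.Coprime q then (1 : ℂ) else 0) =
      ∑ δ ∈ q.divisors, if δ ∣ w then (ArithmeticFunction.moebius δ : ℂ) else 0 := by
    have h := congrArg (fun f : ArithmeticFunction ℤ => f (Nat.gcd w q))
      ArithmeticFunction.moebius_mul_coe_zeta
    simp only [ArithmeticFunction.coe_mul_zeta_apply, ArithmeticFunction.one_apply] at h
    have hdiv : (Nat.gcd w q).divisors = q.divisors.filter (· ∣ w) := by
      ext δ
      simp only [Nat.mem_divisors, mem_filter, Nat.dvd_gcd_iff, ne_eq, Nat.gcd_eq_zero_iff]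
      tauto
    rw [← sum_filter, ← hdiv, ← Int.cast_sum, h]
    simp [Nat.Coprime]
  -- Coprimality is detected by `∑_{δ ∣ gcd(w, q)} μ(δ)`; the sum over multiples of `δ` is then a
  -- complete additive character sum modulo `d = q/δ`.
  have h3 : ∑ w : ZMod q with IsUnit w, ZMod.stdAddChar (w * (k : ZMod q)) =
      ∑ δ ∈ q.divisors, (ArithmeticFunction.moebius δ : ℂ) *
        ∑ w ∈ range q, if δ ∣ w then ZMod.stdAddChar ((w : ZMod q) * (k : ZMod q)) else 0 := by
    rw [h1]
    simp only [mul_sum]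
    rw [sum_comm]
    refine sum_congr rfl fun w _ => ?_
    rw [← one_mul (ZMod.stdAddChar ((w : ZMod q) * (k : ZMod q))), ← zero_mul (ZMod.stdAddChar ((w : ZMod q) * (k : ZMod q))),
      ← ite_mul, h2, sum_mul]
    refine sum_congr rfl fun δ _ => ?_
    split_ifs <;> simp
  rw [h3, ← Nat.sum_div_divisors q fun d => (ArithmeticFunction.moebius (q / d) : ℂ) *
        if (d : ℤ) ∣ k then (d : ℂ) else 0]
  refine sum_congr rfl fun δ hδ => ?_
  obtain ⟨d, hd⟩ := Nat.dvd_of_mem_divisors hδ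
  have hδ0 : 0 < δ := Nat.pos_of_mem_divisors hδ
  have hd0 : d ≠ 0 := by rintro rfl; exact hq (by simpa using hd)
  have hdz : NeZero d := ⟨hd0⟩
  have hqδ : q / δ = d := Nat.div_eq_of_eq_mul_right hδ0 hd
  have hqd : q / d = δ := Nat.div_eq_of_eq_mul_left (Nat.pos_of_ne_zero hd0) hd
  rw [hqδ, hqd, ← sum_stdAddChar_range]
  congr 1
  rw [show range q = range (d * δ) by rw [hd, mul_comm], sum_range_mul_eq,
    sum_eq_single_of_mem 0 (by simpa using hδ0)]
  · refine sum_congr rfl fun t _ => ?_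
    rw [if_pos (by simp)]
    have e1 := ZMod.stdAddChar_coe (N := q) ((0 + δ * t : ℕ) * k)
    have e2 := ZMod.stdAddChar_coe (N := d) (t * k)
    simp only [Int.cast_mul, Int.cast_natCast] at e1 e2
    rw [e1, e2, hd]
    have hδc : (δ : ℂ) ≠ 0 := by exact_mod_cast hδ0.ne'
    have hdc : (d : ℂ) ≠ 0 := by exact_mod_cast hd0
    congr 1
    push_cast
    field_simp
    ring
  · intro x hx hx0
    refine sum_eq_zero fun t _ => if_neg fun h => hx0 ?_
    have : δ ∣ x := (Nat.dvd_add_left (Dvd.intro t rfl)).1 h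
    exact Nat.eq_zero_of_dvd_of_lt this (by simpa using hx)

/-- As `a` is invertible modulo `d`, replacing `i` by `ai` turns the condition into `j ≡ -bi`, so
each `i` has one partner; the sign is the parity of `B̄_n`. -/
theorem sum_congruence_eq_barDedekindSum (m n a b d : ℕ) [NeZero d] (had : a.Coprime d) :
    ∑ i ∈ range d, ∑ j ∈ range d, (if (d : ℤ) ∣ b * i + a * j then
      bernoulliBar m (i / d) * bernoulliBar n (j / d) else 0) =
    (-1) ^ n * barDedekindSum m n a b d := by
  have hper (k : ℕ) : Function.Periodic (fun i : ℤ => bernoulliBar k ((i : ℝ) / d)) (d : ℤ) := by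
    simpa using bernoulliBar_intCast_div_periodic k d 0 1
  have hG : Function.Periodic (fun i : ℤ => ∑ j ∈ range d, (if (d : ℤ) ∣ b * i + a * j then
      bernoulliBar m ((i : ℝ) / d) * bernoulliBar n (j / d) else 0)) (d : ℤ) := fun i => by
    have h1 (j : ℕ) : (d : ℤ) ∣ b * (i + d) + a * j ↔ (d : ℤ) ∣ b * i + a * j := by
      rw [show (b : ℤ) * (i + d) + a * j = b * i + a * j + d * b by ring]
      exact dvd_add_left (Dvd.intro _ rfl)
    have h2 := hper m i
    simp only at h2
    simp only [h1, h2]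
  have h := sum_range_periodic_mul d hG had
  simp only [Int.cast_natCast] at h
  rw [← h, barDedekindSum, mul_sum]
  refine sum_congr rfl fun i _ => ?_
  have hH : Function.Periodic (fun j : ℤ => if (d : ℤ) ∣ b * i + j then
      bernoulliBar n ((j : ℝ) / d) else 0) (d : ℤ) := fun j => by
    have h1 : (d : ℤ) ∣ b * i + (j + d) ↔ (d : ℤ) ∣ b * i + j := by
      rw [← add_assoc]
      exact dvd_add_left dvd_rfl
    have h2 := hper n j
    simp only at h2
    simp only [h1, h2]
  have hs := sum_range_periodic_shift d hH (-(b * i))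
  have hd1 (j : ℕ) : (d : ℤ) ∣ b * (a * i) + a * j ↔ (d : ℤ) ∣ b * i + j := by
    rw [show (b : ℤ) * (a * i) + a * j = a * (b * i + j) by ring]
    exact ⟨IsCoprime.dvd_of_dvd_mul_left (Nat.isCoprime_iff_coprime.2 had.symm),
      fun h => h.mul_left _⟩
  simp only [Int.cast_natCast] at hs
  have hz : (d : ℤ) ∣ b * i + ((0 : ℕ) + -(b * i)) := by simp
  rw [sum_eq_single_of_mem 0 (by simpa using Nat.pos_of_ne_zero (NeZero.ne d)), if_pos hz] at hs
  · calc _ = bernoulliBar m (a * i / d) * ∑ j ∈ range d, (if (d : ℤ) ∣ b * i + j then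
          bernoulliBar n (j / d) else 0) := by
          rw [mul_sum]
          refine sum_congr rfl fun j _ => ?_
          simp only [hd1]
          push_cast
          split_ifs <;> simp
      _ = _ := by
          rw [← hs]
          push_cast
          rw [zero_add, neg_div, bernoulliBar_neg]
          ring
  · intro j hj hj0
    refine if_neg fun h => hj0 ?_
    have : (d : ℤ) ∣ j := by
      convert h using 1; ring
    exact Nat.eq_zero_of_dvd_of_lt (by exact_mod_cast this) (by simpa using hj)

/-- The condition depends only on residues modulo `d`, so writing residues modulo `cd` as `x + dt`
lets Raabe's formula remove `t` in each variable. -/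
theorem sum_congruence_mul (m n a b c d : ℕ) [NeZero c] [NeZero d] (had : a.Coprime d) :
    ∑ i ∈ range (c * d), ∑ j ∈ range (c * d), (if (d : ℤ) ∣ b * i + a * j then
      bernoulliBar m (i / (c * d : ℕ)) * bernoulliBar n (j / (c * d : ℕ)) else 0) =
    (c : ℝ) / c ^ m * (c / c ^ n) * ((-1) ^ n * barDedekindSum m n a b d) := by
  have hc : (c : ℝ) ≠ 0 := NeZero.ne _
  have hd : (d : ℝ) ≠ 0 := NeZero.ne _
  have hraabe (k x : ℕ) : ∑ t ∈ range c, bernoulliBar k ((x + d * t : ℕ) / (c * d : ℕ)) =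
      c / c ^ k * bernoulliBar k (x / d) := by
    have h := sum_bernoulliBar_add_div k c ((x : ℝ) / (c * d))
    have hx : (c : ℝ) * (x / (c * d)) = x / d := by field_simp
    rw [hx] at h
    have hck : (c : ℝ) ^ k ≠ 0 := pow_ne_zero _ hc
    rw [div_mul_eq_mul_div, ← h, mul_div_cancel_left₀ _ hck]
    refine sum_congr rfl fun t _ => ?_
    congr 1
    push_cast
    field_simp
  rw [← sum_congruence_eq_barDedekindSum m n a b d had, sum_range_mul_eq, mul_sum]
  refine sum_congr rfl fun x _ => ?_
  simp only [sum_range_mul_eq c d]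
  rw [sum_comm, mul_sum]
  refine sum_congr rfl fun y _ => ?_
  have hdvd (t s : ℕ) : (d : ℤ) ∣ b * (x + d * t : ℕ) + a * (y + d * s : ℕ) ↔
      (d : ℤ) ∣ b * x + a * y := by
    rw [show (b : ℤ) * (x + d * t : ℕ) + a * (y + d * s : ℕ) =
      b * x + a * y + d * (b * t + a * s) by push_cast; ring]
    exact dvd_add_left (Dvd.intro _ rfl)
  simp only [hdvd]
  split_ifs with h
  · rw [← sum_mul_sum, hraabe, hraabe]
    ring
  · simp

open Classical in
theorem sum_units_lCoeff {q m n a b : ℕ} [NeZero q] (hm : 0 < m)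
    (haq : a.Coprime q) :
    ∑ w : ZMod q with IsUnit w, lCoeff q m (b * w) * lCoeff q n (a * w) =
      (-1) ^ n * (2 * Real.pi * I) ^ (m + n) / (4 * m.factorial * n.factorial * q ^ (m + n)) *
        ((∑ d ∈ q.divisors, (ArithmeticFunction.moebius (q / d) : ℝ) *
          ((d : ℝ) ^ (m + n - 1) * barDedekindSum m n a b d) : ℝ) : ℂ) := by
  have hq : (q : ℂ) ≠ 0 := NeZero.ne _
  set A : ℕ → ℂ := fun k => -(2 * Real.pi * I) ^ k / (2 * k.factorial * q) with hA
  have h1 : ∑ w : ZMod q with IsUnit w, lCoeff q m (b * w) * lCoeff q n (a * w) =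
      A m * A n * ∑ x : ZMod q, ∑ y : ZMod q, bernoulliZMod q m x * bernoulliZMod q n y *
        ∑ w : ZMod q with IsUnit w,
          ZMod.stdAddChar (w * ((-(b * x.val + a * y.val) : ℤ) : ZMod q)) := by
    have h (w : ZMod q) : lCoeff q m (b * w) * lCoeff q n (a * w) =
        A m * A n * ∑ x : ZMod q, ∑ y : ZMod q, bernoulliZMod q m x * bernoulliZMod q n y *
          ZMod.stdAddChar (w * ((-(b * x.val + a * y.val) : ℤ) : ZMod q)) := by
      rw [lCoeff, lCoeff, mul_mul_mul_comm, sum_mul_sum]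
      refine congrArg (A m * A n * ·) (sum_congr rfl fun x _ => sum_congr rfl fun y _ => ?_)
      have : w * ((-(b * x.val + a * y.val) : ℤ) : ZMod q) = -(x * (b * w)) + -(y * (a * w)) := by
        push_cast
        simp only [ZMod.natCast_zmod_val]
        ring
      rw [this, AddChar.map_add_eq_mul]
      ring
    simp only [h, mul_sum]
    rw [sum_comm]
    refine sum_congr rfl fun x _ => ?_
    rw [sum_comm]
  have h2 : ∑ x : ZMod q, ∑ y : ZMod q, bernoulliZMod q m x * bernoulliZMod q n y *
        ∑ w : ZMod q with IsUnit w,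
          ZMod.stdAddChar (w * ((-(b * x.val + a * y.val) : ℤ) : ZMod q)) =
      ∑ d ∈ q.divisors, (ArithmeticFunction.moebius (q / d) : ℂ) * d *
        ((∑ i ∈ range q, ∑ j ∈ range q, (if (d : ℤ) ∣ b * i + a * j then
          bernoulliBar m (i / q) * bernoulliBar n (j / q) else 0) : ℝ) : ℂ) := by
    have hz (d : ℕ) : ∑ i ∈ range q, ∑ j ∈ range q, (if (d : ℤ) ∣ b * i + a * j then
          bernoulliBar m (i / q) * bernoulliBar n (j / q) else 0) =
        ∑ x : ZMod q, ∑ y : ZMod q, (if (d : ℤ) ∣ b * x.val + a * y.val then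
          bernoulliBar m (x.val / q) * bernoulliBar n (y.val / q) else 0) := by
      have e1 (i : ℤ) := sum_range_eq_sum_zmod q fun j : ℤ =>
        if (d : ℤ) ∣ b * i + a * j then
          bernoulliBar m ((i : ℝ) / q) * bernoulliBar n ((j : ℝ) / q) else 0
      have e2 := sum_range_eq_sum_zmod q fun i : ℤ => ∑ y : ZMod q,
        if (d : ℤ) ∣ b * i + a * (y.val : ℤ) then
          bernoulliBar m ((i : ℝ) / q) * bernoulliBar n (((y.val : ℤ) : ℝ) / q) else 0
      simp only [← e1] at e2
      simp only [Int.cast_natCast] at e1 e2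
      rw [e2]
      exact sum_congr rfl fun x _ => by simpa using e1 x.val
    simp only [hz, sum_units_stdAddChar, ofReal_sum, mul_sum]
    simp only [sum_comm (t := q.divisors)]
    refine sum_congr rfl fun d _ => sum_congr rfl fun x _ => sum_congr rfl fun y _ => ?_
    simp only [dvd_neg, bernoulliZMod]
    split_ifs <;> push_cast <;> ring
  rw [h1, h2, ofReal_sum, mul_sum, mul_sum]
  refine sum_congr rfl fun d hd => ?_
  obtain ⟨c, hc⟩ := Nat.dvd_of_mem_divisors hd
  rw [mul_comm d c] at hc
  have hq0 : q ≠ 0 := NeZero.ne q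
  have hdz : NeZero d := ⟨(Nat.pos_of_mem_divisors hd).ne'⟩
  have hcz : NeZero c := ⟨by rintro rfl; exact hq0 (by simpa using hc)⟩
  have hcc : (c : ℂ) ≠ 0 := NeZero.ne _
  have hdc : (d : ℂ) ≠ 0 := NeZero.ne _
  have had : a.Coprime d := haq.coprime_dvd_right (Nat.dvd_of_mem_divisors hd)
  have h3 := sum_congruence_mul m n a b c d had
  rw [← hc] at h3
  rw [h3]
  obtain ⟨N, hN⟩ : ∃ N, m + n = N + 1 := ⟨m + n - 1, by lia⟩
  have hm0 : (m.factorial : ℂ) ≠ 0 := by exact_mod_cast m.factorial_ne_zero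
  have hn0 : (n.factorial : ℂ) ≠ 0 := by exact_mod_cast n.factorial_ne_zero
  have hqc : (q : ℂ) = c * d := by rw [hc]; push_cast; rfl
  have hAA : A m * A n = (2 * Real.pi * I) ^ (m + n) /
      (4 * m.factorial * n.factorial * (c * d) ^ 2) := by
    simp only [hA, hqc]
    rw [pow_add]
    field_simp
    ring
  rw [hAA, hqc, hN, Nat.add_sub_cancel, ← hN]
  have hcp : (c : ℂ) / c ^ m * (c / c ^ n) = c ^ 2 / c ^ (m + n) := by
    rw [div_mul_div_comm, ← pow_add, sq]
  have hdp : (d : ℂ) ^ (m + n) = d ^ N * d := by rw [hN, pow_succ]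
  push_cast
  rw [hcp, mul_pow (c : ℂ) d (m + n), hdp]
  field_simp

end DirichletMean

/-! ### Jordan's totient and summation over the divisors. -/

namespace DirichletMean

open Finset Complex

/-- Expand the product over the radical of `q`; the other divisors of `q` are not squarefree, and
`μ` kills them. -/
theorem prod_one_sub_inv_pow_primeFactors {α q : ℕ} (hq : q ≠ 0) :
    ∏ p ∈ q.primeFactors, (1 - 1 / (p : ℝ) ^ α) =
      ∑ d ∈ q.divisors, (ArithmeticFunction.moebius d : ℝ) * (1 / (d : ℝ) ^ α) := by
  set f : ArithmeticFunction ℝ := ⟨fun d => if d = 0 then 0 else 1 / (d : ℝ) ^ α, by simp⟩ with hf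
  have hf' {d : ℕ} (hd : d ≠ 0) : f d = 1 / (d : ℝ) ^ α := if_neg hd
  have hmul : f.IsMultiplicative := by
    rw [ArithmeticFunction.IsMultiplicative.iff_ne_zero]
    refine ⟨by simp [hf' one_ne_zero], fun {x y} hx hy _ => ?_⟩
    rw [hf' hx, hf' hy, hf' (mul_ne_zero hx hy)]
    push_cast
    rw [mul_pow]
    field_simp
  set r := ∏ p ∈ q.primeFactors, p with hr
  have hrsq : Squarefree r := by
    rw [hr, ← Nat.radical_eq_prod_primeFactors]
    exact UniqueFactorizationMonoid.squarefree_radical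
  have hrq : r ∣ q := Nat.prod_primeFactors_dvd q
  have hrp : r.primeFactors = q.primeFactors := Nat.primeFactors_prod_primeFactors q
  have h := hmul.prodPrimeFactors_one_sub_of_squarefree f hrsq
  rw [hrp] at h
  have h1 : ∏ p ∈ q.primeFactors, (1 - 1 / (p : ℝ) ^ α) = ∏ p ∈ q.primeFactors, (1 - f p) :=
    prod_congr rfl fun p hp => by rw [hf' (Nat.prime_of_mem_primeFactors hp).ne_zero]
  rw [h1, h]
  refine (sum_subset (Nat.divisors_subset_of_dvd hq hrq) fun d hd hdr => ?_).trans
    (sum_congr rfl fun d hd => by rw [hf' (Nat.pos_of_mem_divisors hd).ne'])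
  have hns : ¬ Squarefree d := by
    intro hsq
    apply hdr
    rw [Nat.mem_divisors]
    refine ⟨?_, hrsq.ne_zero⟩
    rw [← Nat.prod_primeFactors_of_squarefree hsq]
    exact prod_dvd_prod_of_subset _ _ _
      (Nat.primeFactors_mono (Nat.dvd_of_mem_divisors hd) hq)
  rw [ArithmeticFunction.moebius_eq_zero_of_not_squarefree hns]
  simp

theorem pow_mul_prod_primeFactors {α q : ℕ} (hq : q ≠ 0) :
    (q : ℝ) ^ α * ∏ p ∈ q.primeFactors, (1 - 1 / (p : ℝ) ^ α) =
      ∑ d ∈ q.divisors, (ArithmeticFunction.moebius (q / d) : ℝ) * (d : ℝ) ^ α := by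
  rw [prod_one_sub_inv_pow_primeFactors hq, mul_sum,
    ← Nat.sum_div_divisors q fun d => (ArithmeticFunction.moebius (q / d) : ℝ) * (d : ℝ) ^ α]
  refine sum_congr rfl fun δ hδ => ?_
  obtain ⟨d, hd⟩ := Nat.dvd_of_mem_divisors hδ
  have hδ0 : 0 < δ := Nat.pos_of_mem_divisors hδ
  have hd0 : d ≠ 0 := by rintro rfl; exact hq (by simpa using hd)
  rw [Nat.div_eq_of_eq_mul_right hδ0 hd,
    Nat.div_eq_of_eq_mul_left (Nat.pos_of_ne_zero hd0) hd, hd]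
  have : (δ : ℝ) ≠ 0 := by exact_mod_cast hδ0.ne'
  push_cast
  rw [mul_pow]
  field_simp

theorem jordanTotient_natCast (α : ℕ) {q : ℕ} (hq : q ≠ 0) :
    jordanTotient α q =
      ((∑ d ∈ q.divisors, (ArithmeticFunction.moebius (q / d) : ℝ) * (d : ℝ) ^ α : ℝ) : ℂ) := by
  rw [jordanTotient, ← pow_mul_prod_primeFactors hq]
  push_cast
  simp only [cpow_natCast]

theorem sum_moebius_mul_eq_totient {q : ℕ} (hq : q ≠ 0) :
    ∑ d ∈ q.divisors, (ArithmeticFunction.moebius (q / d) : ℝ) * (d : ℝ) = q.totient := by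
  have h := pow_mul_prod_primeFactors (α := 1) hq
  simp only [pow_one] at h
  rw [← h]
  have h2 := Nat.totient_eq_mul_prod_factors q
  have h3 : ((q.totient : ℚ) : ℝ) = ((q * ∏ p ∈ q.primeFactors, (1 - (p : ℚ)⁻¹) : ℚ) : ℝ) := by
    rw [h2]
  push_cast at h3
  rw [h3]
  simp only [one_div]

/-- Reciprocity is summed against `μ(q/d)`: the `d^(m+n)` term yields `J_{m+n}(q)` and the `d/4`
term yields `φ(q)/4`. No parity of `m + n` is assumed, which serves the odd case of the theorem. -/
theorem sum_barDedekindSum {q m n a b : ℕ} [NeZero q] (hm : 0 < m) (hn : 0 < n) (ha : 0 < a)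
    (hb : 0 < b) (haq : a.Coprime q) (hbq : b.Coprime q) :
    ((∑ d ∈ q.divisors, (ArithmeticFunction.moebius (q / d) : ℝ) *
      ((d : ℝ) ^ (m + n - 1) * barDedekindSum m n a b d) : ℝ) : ℂ) =
    (-1) ^ (m + n) * (R m n q a b + R n m q b a) + C₁ m n q a b := by
  have hq : q ≠ 0 := NeZero.ne q
  have haz : NeZero a := ⟨ha.ne'⟩
  have hbz : NeZero b := ⟨hb.ne'⟩
  have h1 : ∀ d ∈ q.divisors, (ArithmeticFunction.moebius (q / d) : ℝ) *
      ((d : ℝ) ^ (m + n - 1) * barDedekindSum m n a b d) =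
      (-1) ^ (m + n) * ((ArithmeticFunction.moebius (q / d) : ℝ) * divisorTerm m n a b d +
        (ArithmeticFunction.moebius (q / d) : ℝ) * divisorTerm n m b a d) +
      (-1) ^ (n - 1) * m.factorial * n.factorial * (Nat.gcd a b : ℝ) ^ (m + n) *
        bernoulli (m + n) / (a ^ n * b ^ m * (m + n).factorial) *
          ((ArithmeticFunction.moebius (q / d) : ℝ) * d ^ (m + n)) -
      (if m = 1 ∧ n = 1 then 1 / 4 else 0) * ((ArithmeticFunction.moebius (q / d) : ℝ) * d) := by
    intro d hd
    have hdz : NeZero d := ⟨(Nat.pos_of_mem_divisors hd).ne'⟩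
    have hdq := Nat.dvd_of_mem_divisors hd
    rw [barDedekindSum_reciprocity hm hn (haq.coprime_dvd_right hdq) (hbq.coprime_dvd_right hdq)]
    split_ifs <;> ring
  rw [sum_congr rfl h1, sum_sub_distrib, sum_add_distrib, ← mul_sum, ← mul_sum, ← mul_sum,
    sum_add_distrib, ← R_eq_sum_divisorTerm, ← R_eq_sum_divisorTerm,
    sum_moebius_mul_eq_totient hq, C₁, jordanTotient_natCast _ hq, kroneckerDelta, kroneckerDelta]
  by_cases h1 : m = 1 <;> by_cases h2 : n = 1 <;> simp [h1, h2, Ne.symm] <;> ring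

theorem barDedekindSum_of_odd {m n : ℕ} (h : Odd (m + n)) (a b d : ℕ) [NeZero d] :
    barDedekindSum m n a b d = 0 := by
  have hp : Function.Periodic (fun i : ℤ => bernoulliBar m ((a : ℝ) * i / d) *
      bernoulliBar n ((b : ℝ) * i / d)) (d : ℤ) := fun i => by
    have h1 := bernoulliBar_intCast_div_periodic m d 0 a i
    have h2 := bernoulliBar_intCast_div_periodic n d 0 b i
    simp only [zero_add, Int.cast_natCast] at h1 h2
    simp only [h1, h2]
  have hs := sum_range_periodic_neg d hp
  have hneg (i : ℕ) : bernoulliBar m ((a : ℝ) * ((-(i : ℤ) : ℤ) : ℝ) / d) *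
      bernoulliBar n ((b : ℝ) * ((-(i : ℤ) : ℤ) : ℝ) / d) =
      -(bernoulliBar m ((a : ℝ) * i / d) * bernoulliBar n ((b : ℝ) * i / d)) := by
    have h1 : ((-1 : ℝ) ^ m) * (-1) ^ n = -1 := by rw [← pow_add]; exact h.neg_one_pow
    push_cast
    rw [mul_neg, mul_neg, neg_div, neg_div, bernoulliBar_neg, bernoulliBar_neg]
    linear_combination (bernoulliBar m ((a : ℝ) * i / d) * bernoulliBar n ((b : ℝ) * i / d)) * h1
  simp only [hneg, sum_neg_distrib, Int.cast_natCast] at hs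
  rw [barDedekindSum]
  linarith

theorem neg_one_cpow_half_sub (m n : ℕ) :
    (-1 : ℂ) ^ (((m : ℂ) - n) / 2) = (-1) ^ n * I ^ (m + n) := by
  rw [cpow_def_of_ne_zero (by simp), log_neg_one,
    show Real.pi * I * (((m : ℂ) - n) / 2) =
      m * (Real.pi / 2 * I) + n * (-(Real.pi / 2 * I)) by ring,
    Complex.exp_add, Complex.exp_nat_mul, Complex.exp_nat_mul, Complex.exp_neg,
    Complex.exp_pi_div_two_mul_I, inv_I, pow_add, neg_pow I n]
  ring

end DirichletMean

/-! ### The mean value formula. -/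

theorem theorem2p1 (q m n a b : ℕ) [NeZero q] (hm : 0 < m) (hn : 0 < n) (ha : 0 < a) (hb : 0 < b)
    (haq : Nat.Coprime a q) (hbq : Nat.Coprime b q) :
    DirichletMean.V q m n a b =
      (-1 : ℂ) ^ (((m : ℂ) - (n : ℂ)) / 2) * (2 * (Real.pi : ℂ)) ^ (m + n) * (Nat.totient q : ℂ) /
          (4 * (q : ℂ) ^ (m + n) * (m.factorial : ℂ) * (n.factorial : ℂ)) *
        ((DirichletMean.R m n q a b : ℂ) + (DirichletMean.R n m q b a : ℂ) +
          DirichletMean.C₁ m n q a b) := by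
  have hsum := DirichletMean.sum_barDedekindSum hm hn ha hb haq hbq
  rcases Nat.even_or_odd (m + n) with h | h
  · have hmn : ((-1) ^ m : ℂ) = (-1) ^ n := by
      have h1 : ((-1 : ℂ) ^ m) * (-1) ^ n = 1 := by rw [← pow_add]; exact h.neg_one_pow
      have h2 : ((-1 : ℂ) ^ n) * (-1) ^ n = 1 := by rw [← mul_pow]; simp
      linear_combination (-1 : ℂ) ^ n * h1 - (-1 : ℂ) ^ m * h2
    rw [h.neg_one_pow, one_mul] at hsum
    have hV := DirichletMean.V_eq_sum_units hm hn haq hbq hmn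
    rw [DirichletMean.sum_units_lCoeff hm haq, hsum] at hV
    rw [hV, DirichletMean.neg_one_cpow_half_sub, mul_pow _ Complex.I]
    ring
  · have hmn : ((-1) ^ m : ℂ) ≠ (-1) ^ n := by
      intro h'
      have h1 : ((-1 : ℂ) ^ m) * (-1) ^ n = -1 := by rw [← pow_add]; exact h.neg_one_pow
      rw [h', ← mul_pow] at h1
      norm_num at h1
    have hV : DirichletMean.V q m n a b = 0 := by
      simp [DirichletMean.V, hmn]
    have hC : DirichletMean.C₁ m n q a b = 0 := by
      have hB : bernoulli (m + n) = 0 := bernoulli_eq_zero_of_odd h (by lia)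
      have hd : DirichletMean.kroneckerDelta 1 m * DirichletMean.kroneckerDelta 1 n = 0 := by
        rw [DirichletMean.kroneckerDelta, DirichletMean.kroneckerDelta]
        split_ifs with h1 h2
        · subst h1 h2; exact absurd h (by decide)
        all_goals simp
      rw [DirichletMean.C₁, hB, hd]
      simp
    -- All Dedekind sums vanish under `h ↦ -h`, so `hsum` now reads `0 = -(R + R')`, with `R` and
    -- `R'` the two `R`-terms.
    rw [Finset.sum_eq_zero fun d hd => ?_, hC, h.neg_one_pow] at hsum
    · have h0 : (DirichletMean.R m n q a b : ℂ) + DirichletMean.R n m q b a = 0 := by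
        rw [Complex.ofReal_zero] at hsum
        linear_combination hsum
      rw [hV, h0, hC]
      simp
    · have : NeZero d := ⟨(Nat.pos_of_mem_divisors hd).ne'⟩
      rw [DirichletMean.barDedekindSum_of_odd h]
      simp
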